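/- Let $d,k\ge 1$ be integers. A $(d+1)$-regular tree of depth $k$ is a finite rooted tree $\mathcal G$ with root $v_*$ in which $v_*$ has $d+1$ children, every vertex at distance $1,\dots,k-1$ from $v_*$ has $d$ children, and the vertices at distance $k$ from $v_*$ are the leaves. Let $\mathcal V$ be its vertex set and $N=|\mathcal V|$. A labeling of $\mathcal G$ is a bijection $L:\mathcal V\to\{1,\dots,N\}$; a vertex $x$ is a peak of $L$ if $L(x)>L(y)$ for every neighbour $y$ of $x$. Let $\mathbb P_2$ denote the law of a uniformly random labeling of $\mathcal G$ conditioned on having exactly two peaks, let $K_1$ and $K_2$ be the locations of the peaks with the higher and the lower label, respectively, and let $\operatorname{dist}$ be the graph distance. **Theorem 7.2.** (a) If $d\ge 10$ and $k\ge 2$, then the function $(y_1,y_2)\mapsto \mathbb P_2(K_1=y_1,K_2=y_2)$ on $\mathcal V\times\mathcal V$ takes its maximum value only at pairs with $y_1=v_*$. (b) If $d\ge 3$, $k\ge 2$ and $m\ge\sqrt{8k}$ ($m$ real), then $$\mathbb P_2\Big(\min_{i=1,2}\operatorname{dist}(K_i,v_*)\ge m\Big)\le 8\exp\big(-(m/2)\log(d-1)\big).$$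 (c) For every $d\ge 3$ there exists $c_1>0$ such that for all $k\ge 2$ and all $y_1,y_2\in\mathcal V$ with $\operatorname{dist}(y_i,v_*)\ge 2$ for $i=1,2$, $$\mathbb P_2(K_1=v_*,K_2=y_1)\ge c_1\,\mathbb P_2(K_1=v_*,K_2=y_2).$$ (d) For every $d\ge 3$ there exist $c,c'>0$ such that for all $k\ge 2$ and all real $n\ge 2\sqrt{8k}$, $$\mathbb P_2\big(|\operatorname{dist}(K_1,K_2)-k|\ge n\big)\le 8\exp\big(-(n/4)\log(d-1)\big)+c\exp\big(-(n/2)\log d\big)\le c'\exp\big(-(\sqrt k/64)\log d\big).$$ -/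

import Mathlib

open MeasureTheory ProbabilityTheory

universe u

/-- `G` is a `(d+1)`-regular tree of depth `k` with root `r`: a tree in which the root has `d + 1`
children, every vertex of generation `1, …, k - 1` has `d` children, and the vertices of
generation `k` have no children. The generation of a vertex is its distance to the root, and the
children of `v` are the neighbours of `v` in the next generation. -/
structure IsRegularTree {V : Type u} (G : SimpleGraph V) (r : V) (d k : ℕ) : Prop where
  isTree : G.IsTree
  depth_le : ∀ v, G.dist r v ≤ k
  root_children : 0 < k → {w | G.Adj r w ∧ G.dist r w = 1}.ncard = d + 1
  children : ∀ v, 0 < G.dist r v → G.dist r v < k →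
    {w | G.Adj v w ∧ G.dist r w = G.dist r v + 1}.ncard = d

/-- A labeling of a finite vertex set `V` with `N` elements is a bijection onto a set of `N`
consecutive integers. (Only the order of labels matters; the labels here are `0, …, N - 1`.) -/
abbrev Labeling (V : Type u) [Fintype V] : Type u := V ≃ Fin (Fintype.card V)

instance Labeling.instMeasurableSpace (V : Type u) [Fintype V] : MeasurableSpace (Labeling V) := ⊤

instance Labeling.instDiscreteMeasurableSpace (V : Type u) [Fintype V] :
    DiscreteMeasurableSpace (Labeling V) := ⟨fun _ => trivial⟩

section Peaks

variable {V : Type u} [Fintype V]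

/-- `x` is a peak (strict local maximum) of the labeling `L`. -/
def IsPeak (G : SimpleGraph V) (L : Labeling V) (x : V) : Prop :=
  ∀ y, G.Adj x y → L y < L x

/-- The event that the labeling has exactly `j` peaks. -/
def peakCountEvent (G : SimpleGraph V) (j : ℕ) : Set (Labeling V) :=
  {L | {x | IsPeak G L x}.ncard = j}

/-- `x` is the location `K₁` of the highest peak of `L`. -/
def IsHighestPeak (G : SimpleGraph V) (L : Labeling V) (x : V) : Prop :=
  IsPeak G L x ∧ ∀ y, IsPeak G L y → L y ≤ L x

/-- `x` is the location `K₂` of the second highest peak of `L`: a peak, and exactly one peak has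
a larger label. -/
def IsSecondHighestPeak (G : SimpleGraph V) (L : Labeling V) (x : V) : Prop :=
  IsPeak G L x ∧ {y | IsPeak G L y ∧ L x < L y}.ncard = 1

/-- The event `{R K₁ K₂}` for a relation `R` between vertices. -/
def peakPairEvent (G : SimpleGraph V) (R : V → V → Prop) : Set (Labeling V) :=
  {L | ∃ x y, IsHighestPeak G L x ∧ IsSecondHighestPeak G L y ∧ R x y}

/-- The law of a uniformly random labeling. -/
noncomputable def labelingLaw (V : Type u) [Fintype V] : Measure (Labeling V) :=
  uniformOn Set.univ

/-- The law of a uniformly random labeling conditioned on having exactly two peaks. -/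
noncomputable def twinPeaksLaw (G : SimpleGraph V) : Measure (Labeling V) :=
  (labelingLaw V)[|peakCountEvent G 2]

/-- The conditional probability, given that there are exactly two peaks, that the locations
`K₁, K₂` of the highest and the second highest peak satisfy `R K₁ K₂`. -/
noncomputable def twinPeaksProb (G : SimpleGraph V) (R : V → V → Prop) : ℝ :=
  (twinPeaksLaw G).real (peakPairEvent G R)

end Peaks

/-! ### The hook length formula for laminar families of sets. -/

section HookFormula

variable {V : Type u} [Fintype V]

/-! The whole proof compares counts of labelings with the number `S` of labelings that decrease away
from the root.

Pigeonhole: orient each of the `N - 1` edges to its endpoint with the smaller label. This endpoint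
is never a peak, and with two peaks there are only `N - 2` other vertices, so two edges share their
lower end (`exists_lowerEnd_eq`). Deleting either of them creates no new local maximum, so the
deleted edge separates the peaks and the labeling is unimodal on both components. Hence twice the
number of labelings with peaks `x`, `y` is at most a sum, over the edges between `x` and `y`, of
numbers of labelings of a two-component forest with prescribed component maxima
(`two_mul_card_twinLabelings_le`).

Each of these numbers is `N!` divided by a product of hook sizes (`card_rerootedLabelings_mul`), as
is `S`, so their ratio is a product of ratios of subtree sizes. Cutting above `q` shrinks the hooks
of the ancestors of `q`, which costs at most a factor `(d-1)/(d-2)`. Moving the maximum from the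
root to `a` inverts the hooks on the path to `a` and gives `movingCost`, whose decay is
superexponential in the depth. Moving it from `q` down to `b` gives a power of `1/(d-1)`
(`factor_le`). Summing over the cut edge is a geometric series and yields `card_twinLabelings_le`.

Conversely, a forest labeling with maxima at the root and at `q` either has exactly these two peaks
in the tree or decreases away from the root; for `q` of depth at least 2 this leaves at least `S /
d` labelings (`card_twinLabelings_root_ge`).

Part (a) sharpens the upper bound to less than `S / d` when the highest peak is not the root; (c)
compares `4 * S` with `S / d`. For (b), `movingCost` is summed over generations against a
denominator of at least `d ^ k * S / d`. For (d), a distance between the peaks far from `k` forces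
both peaks to be far from the root or both to be far from the leaves. -/

/-- The number of elements of `D` whose label is smaller than that of `x`. -/
def labelRank (L : Labeling V) (D : Finset V) (x : V) : ℕ := (D.filter (fun w => L w < L x)).card

lemma labelRank_lt_labelRank {L : Labeling V} {D : Finset V} {x y : V} (hx : x ∈ D)
    (hxy : L x < L y) : labelRank L D x < labelRank L D y := by
  apply Finset.card_lt_card
  rw [Finset.ssubset_iff_of_subset]
  · exact ⟨x, by simp [hx, hxy], by simp⟩
  · intro w hw
    simp only [Finset.mem_filter] at hw ⊢
    exact ⟨hw.1, hw.2.trans hxy⟩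

lemma labelRank_lt_card {L : Labeling V} {D : Finset V} {x : V} (hx : x ∈ D) :
    labelRank L D x < D.card := by
  apply Finset.card_lt_card
  rw [Finset.ssubset_iff_of_subset (Finset.filter_subset _ _)]
  exact ⟨x, hx, by simp⟩

lemma labelRank_injOn (L : Labeling V) (D : Finset V) : Set.InjOn (labelRank L D) D := by
  intro x hx y hy h
  rcases lt_trichotomy (L x) (L y) with h1 | h1 | h1
  · exact absurd h (labelRank_lt_labelRank hx h1).ne
  · exact L.injective h1
  · exact absurd h (labelRank_lt_labelRank hy h1).ne'

lemma exists_labelRank_eq (L : Labeling V) (D : Finset V) {j : ℕ} (hj : j < D.card) :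
    ∃ w ∈ D, labelRank L D w = j := by
  have h : D.image (labelRank L D) = Finset.range D.card := by
    apply Finset.eq_of_subset_of_card_le
    · intro i hi
      obtain ⟨x, hx, rfl⟩ := Finset.mem_image.1 hi
      exact Finset.mem_range.2 (labelRank_lt_card hx)
    · rw [Finset.card_image_of_injOn (labelRank_injOn L D), Finset.card_range]
  have h2 : j ∈ D.image (labelRank L D) := by rw [h]; exact Finset.mem_range.2 hj
  obtain ⟨w, hw, h⟩ := Finset.mem_image.1 h2
  exact ⟨w, hw, h⟩

variable [DecidableEq V]

lemma labelRank_swap (L : Labeling V) {D : Finset V} {v w : V} (hv : v ∈ D) (hw : w ∈ D) (x : V) :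
    labelRank ((Equiv.swap v w).trans L) D x = labelRank L D (Equiv.swap v w x) := by
  unfold labelRank
  have hmem : ∀ y, Equiv.swap v w y ∈ D ↔ y ∈ D := by
    intro y
    rw [Equiv.swap_apply_def]
    split_ifs with h1 h2 <;> simp_all
  refine Finset.card_bij' (fun y _ => Equiv.swap v w y) (fun y _ => Equiv.swap v w y) ?_ ?_ ?_ ?_
  · intro y hy
    have hy := Finset.mem_filter.1 hy
    exact Finset.mem_filter.2 ⟨(hmem y).2 hy.1, hy.2⟩
  · intro y hy
    have hy := Finset.mem_filter.1 hy
    refine Finset.mem_filter.2 ⟨(hmem y).2 hy.1, ?_⟩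
    simpa using hy.2
  · simp
  · simp

-- No label of `D` lies strictly between two consecutive ranks, so every third element of `D`
-- compares in the same way with both.
omit [DecidableEq V] in
lemma lt_iff_lt_of_labelRank_succ {L : Labeling V} {D : Finset V} {v w x : V} (hv : v ∈ D)
    (hw : w ∈ D) (hvw : labelRank L D w = labelRank L D v + 1) (hx : x ∈ D) (hxv : x ≠ v) :
    L x < L v ↔ L x < L w := by
  have h1 : L v < L w := by
    by_contra h
    rcases (not_lt.1 h).lt_or_eq with h | h
    · have := labelRank_lt_labelRank (L := L) hw h
      omega
    · rw [L.injective h] at hvw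
      omega
  refine ⟨fun h => h.trans h1, fun h => ?_⟩
  by_contra h2
  have h3 : L v < L x := lt_of_le_of_ne (not_lt.1 h2) (fun h => hxv (L.injective h).symm)
  have := labelRank_lt_labelRank (L := L) hv h3
  have := labelRank_lt_labelRank (L := L) hx h
  omega

/-- If a set of labelings is stable under exchanging `v` with a neighbour in the order of the
labels of `D`, then `v` is equally likely to have each rank in `D`. -/
lemma card_filter_max_mul_card (E : Finset (Labeling V)) {D : Finset V} {v : V} (hv : v ∈ D)
    (hE : ∀ L ∈ E, ∀ w ∈ D, w ≠ v →
      (∀ x ∈ D, x ≠ v → x ≠ w → (L x < L v ↔ L x < L w)) → (Equiv.swap v w).trans L ∈ E) :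
    (E.filter (fun L => ∀ w ∈ D, L w ≤ L v)).card * D.card = E.card := by
  classical
  let R : ℕ → Finset (Labeling V) := fun j => E.filter (fun L => labelRank L D v = j)
  -- Exchanging `v` with the element of the next rank is a bijection between the two rank classes;
  -- its inverse exchanges `v` with the element that now has rank `j`.
  have hstep : ∀ j, j + 1 < D.card → (R j).card = (R (j + 1)).card := by
    intro j hj
    choose f hfD hf using fun L : Labeling V => exists_labelRank_eq L D hj
    choose f' hfD' hf' using fun L : Labeling V => exists_labelRank_eq L D (j.lt_succ_self.trans hj)
    have key : ∀ L, labelRank L D v = j → labelRank ((Equiv.swap v (f L)).trans L) D v = j + 1 ∧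
        f' ((Equiv.swap v (f L)).trans L) = f L := by
      intro L hL
      constructor
      · rw [labelRank_swap L hv (hfD L), Equiv.swap_apply_left, hf]
      · apply labelRank_injOn ((Equiv.swap v (f L)).trans L) D (hfD' _) (hfD _)
        rw [hf', labelRank_swap L hv (hfD L), Equiv.swap_apply_right, hL]
    have key' : ∀ L, labelRank L D v = j + 1 → labelRank ((Equiv.swap v (f' L)).trans L) D v = j ∧
        f ((Equiv.swap v (f' L)).trans L) = f' L := by
      intro L hL
      constructor
      · rw [labelRank_swap L hv (hfD' L), Equiv.swap_apply_left, hf']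
      · apply labelRank_injOn ((Equiv.swap v (f' L)).trans L) D (hfD _) (hfD' _)
        rw [hf, labelRank_swap L hv (hfD' L), Equiv.swap_apply_right, hL]
    have hinv : ∀ (L : Labeling V) (w : V),
        (Equiv.swap v w).trans ((Equiv.swap v w).trans L) = L := by
      intro L w; ext x; simp
    refine Finset.card_bij' (fun L _ => (Equiv.swap v (f L)).trans L)
      (fun L _ => (Equiv.swap v (f' L)).trans L) ?_ ?_ ?_ ?_
    · intro L hL
      simp only [R, Finset.mem_filter] at hL ⊢
      refine ⟨hE L hL.1 _ (hfD L) ?_ ?_, (key L hL.2).1⟩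
      · intro h
        have := hf L
        rw [h] at this
        omega
      · intro x hx hxv _
        exact lt_iff_lt_of_labelRank_succ hv (hfD L) (by rw [hf, hL.2]) hx hxv
    · intro L hL
      simp only [R, Finset.mem_filter] at hL ⊢
      refine ⟨hE L hL.1 _ (hfD' L) ?_ ?_, (key' L hL.2).1⟩
      · intro h
        have := hf' L
        rw [h] at this
        omega
      · intro x hx _ hxw
        exact (lt_iff_lt_of_labelRank_succ (hfD' L) hv (by rw [hf', hL.2]) hx hxw).symm
    · intro L hL
      simp only [R, Finset.mem_filter] at hL
      simp only [(key L hL.2).2, hinv]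
    · intro L hL
      simp only [R, Finset.mem_filter] at hL
      simp only [(key' L hL.2).2, hinv]
  have hpos : 0 < D.card := Finset.card_pos.2 ⟨v, hv⟩
  have hconst : ∀ j, j < D.card → (R (D.card - 1 - j)).card = (R (D.card - 1)).card := by
    intro j
    induction j with
    | zero => intro _; rfl
    | succ j ih =>
      intro hj
      rw [← ih (by omega), hstep _ (by omega)]
      congr 2
      omega
  have htop : E.filter (fun L => ∀ w ∈ D, L w ≤ L v) = R (D.card - 1) := by
    ext L
    simp only [R, Finset.mem_filter]
    refine and_congr_right fun _ => ⟨fun h => ?_, fun h w hw => ?_⟩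
    · have : D.filter (fun w => L w < L v) = D.erase v := by
        ext w
        simp only [Finset.mem_filter, Finset.mem_erase]
        refine ⟨fun hw => ⟨fun h => by simp [h] at hw, hw.1⟩, fun hw => ⟨hw.2, ?_⟩⟩
        exact lt_of_le_of_ne (h w hw.2) (fun h => hw.1 (L.injective h))
      rw [labelRank, this, Finset.card_erase_of_mem hv]
    · by_contra hlt
      have h1 := labelRank_lt_labelRank (L := L) hv (not_le.1 hlt)
      have h2 := labelRank_lt_card (L := L) hw
      omega
  have hsum : E.card = ∑ j ∈ Finset.range D.card, (R j).card :=
    Finset.card_eq_sum_card_fiberwise (fun L _ => by simpa using labelRank_lt_card hv)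
  rw [htop, hsum, Finset.sum_congr rfl (g := fun _ => (R (D.card - 1)).card)]
  · simp [mul_comm]
  · intro j hj
    rw [Finset.mem_range] at hj
    rw [← hconst (D.card - 1 - j) (by omega)]
    congr 2
    omega

/-- The hook length formula for a laminar family of sets with base points. -/
theorem card_labelings_mul_prod_card {ι : Type*} [DecidableEq ι] (s : Finset ι) (β : ι → V)
    (D : ι → Finset V) (hmem : ∀ i ∈ s, β i ∈ D i)
    (hlam : ∀ i ∈ s, ∀ j ∈ s, i ≠ j →
      (D i ⊆ D j ∧ β j ∉ D i) ∨ (D j ⊆ D i ∧ β i ∉ D j) ∨ Disjoint (D i) (D j)) :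
    (Finset.univ.filter (fun L : Labeling V => ∀ i ∈ s, ∀ w ∈ D i, L w ≤ L (β i))).card *
      ∏ i ∈ s, (D i).card = (Fintype.card V).factorial := by
  -- The sets are added by increasing size. The conditions for the smaller sets are invariant under
  -- exchanging `β j` with a rank neighbour in the new, largest set, so `β j` dominates that set in
  -- exactly one out of `(D j).card` of the labelings.
  induction s using Finset.induction_on_max_value (fun i => (D i).card) with
  | empty =>
    simp only [Finset.notMem_empty, false_imp_iff, implies_true, Finset.filter_true,
      Finset.prod_empty, mul_one, Finset.card_univ]
    rw [Fintype.card_equiv (Fintype.equivFin V)]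
  | insert j s hj hmax ih =>
    rw [Finset.prod_insert hj, ← ih (fun i hi => hmem i (Finset.mem_insert_of_mem hi))
      (fun i hi i' hi' => hlam i (Finset.mem_insert_of_mem hi) i' (Finset.mem_insert_of_mem hi')),
      ← mul_assoc]
    congr 1
    let E : Finset (Labeling V) :=
      Finset.univ.filter (fun L : Labeling V => ∀ i ∈ s, ∀ w ∈ D i, L w ≤ L (β i))
    have hE := card_filter_max_mul_card E (D := D j) (v := β j) (hmem j (Finset.mem_insert_self _ _))
    rw [Finset.filter_filter] at hE
    refine Eq.trans ?_ (hE ?_)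
    · congr 2
      ext L
      simp only [Finset.mem_filter, Finset.mem_univ, true_and, Finset.mem_insert,
        forall_eq_or_imp]
      exact and_comm
    · intro L hL w hw hwv hcons
      simp only [E, Finset.mem_filter, Finset.mem_univ, true_and] at hL ⊢
      intro i hi x hx
      have hβi := hmem i (Finset.mem_insert_of_mem hi)
      have hL1 : ∀ y ∈ D i, y ≠ β i → L y < L (β i) := fun y hy hne =>
        lt_of_le_of_ne (hL i hi y hy) (fun h => hne (L.injective h))
      have hnot : β j ∉ D i := by
        rcases hlam i (Finset.mem_insert_of_mem hi) j (Finset.mem_insert_self _ _)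
          (fun h => hj (h ▸ hi)) with h | h | h
        · exact h.2
        · have : (D j).card < (D i).card := Finset.card_lt_card
            ((Finset.ssubset_iff_of_subset h.1).2 ⟨β i, hβi, h.2⟩)
          exact absurd (hmax i hi) (not_le.2 this)
        · exact fun h' => Finset.disjoint_left.1 h h' (hmem j (Finset.mem_insert_self _ _))
      -- The exchange can affect the condition for `D i` only if `w ∈ D i`; then `D i` lies inside
      -- `D j`, and the rank-neighbour hypothesis applies to all of its elements.
      have hsub : w ∈ D i → D i ⊆ D j := by
        intro hwi
        rcases hlam i (Finset.mem_insert_of_mem hi) j (Finset.mem_insert_self _ _)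
          (fun h => hj (h ▸ hi)) with h | h | h
        · exact h.1
        · rw [Finset.eq_of_subset_of_card_le h.1 (hmax i hi)]
        · exact absurd hw (Finset.disjoint_left.1 h hwi)
      have hxj : x ≠ β j := fun h => hnot (h ▸ hx)
      have hbj : β i ≠ β j := fun h => hnot (h ▸ hβi)
      simp only [Equiv.trans_apply]
      by_cases hxw : x = w
      · by_cases hbw : β i = w
        · rw [hbw, hxw]
        · have hsub' := hsub (hxw ▸ hx)
          rw [hxw, Equiv.swap_apply_right, Equiv.swap_apply_of_ne_of_ne hbj hbw]
          have h1 := hL1 x hx (fun h => hbw (h ▸ hxw))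
          rw [hxw] at h1
          have h2 := hcons (β i) (hsub' hβi) hbj hbw
          by_contra h3
          exact absurd (h2.1 (not_le.1 h3)) (not_lt.2 h1.le)
      · by_cases hbw : β i = w
        · have hsub' := hsub (hbw ▸ hβi)
          rw [hbw, Equiv.swap_apply_right, Equiv.swap_apply_of_ne_of_ne hxj hxw]
          have h1 := hL1 x hx (fun h => hxw (h.trans hbw))
          rw [hbw] at h1
          exact ((hcons x (hsub' hx) hxj hxw).2 h1).le
        · rw [Equiv.swap_apply_of_ne_of_ne hxj hxw, Equiv.swap_apply_of_ne_of_ne hbj hbw]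
          exact hL i hi x hx

end HookFormula

/-! ### Hook products of re-rooted forests. -/

section Forest

/-- `le` is the ancestor order of the forest on `V` with parent map `p`, the roots being the fixed
points of `p`. -/
structure IsForestOrder {V : Type u} (p : V → V) (le : V → V → Prop) : Prop where
  refl : ∀ v, le v v
  trans : ∀ u v w, le u v → le v w → le u w
  antisymm : ∀ u v, le u v → le v u → u = v
  chain : ∀ u v w, le u w → le v w → le u v ∨ le v u
  parent_le : ∀ v, le (p v) v
  le_parent : ∀ u w, le u w → u ≠ w → p w ≠ w ∧ le u (p w)

variable {V : Type u} [Fintype V]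

open Classical in
/-- The sets of the hook length formula for a forest in which each component is re-rooted at its
terminal vertex, given by `τ`, and the vertex `τ top` has to dominate all vertices. -/
noncomputable def rerootedSet (p : V → V) (le : V → V → Prop) (τ : V → V) (top c : V) : Finset V :=
  -- A vertex `c` that is not a root stands for the edge from `c` to `p c`, and its set is the side
  -- of this edge away from the terminal vertex: the rest of the component if the terminal vertex is
  -- below `c`, and the subtree of `c` otherwise. A root stands for its whole component, or for
  -- everything if it is `top`.
  if p c = c then (if c = top then Finset.univ else Finset.univ.filter (fun w => τ w = τ c))
  else if le c (τ c) then Finset.univ.filter (fun w => τ w = τ c ∧ ¬ le c w)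
  else Finset.univ.filter (fun w => le c w)

open Classical in
/-- The base points of the sets `rerootedSet`. -/
noncomputable def rerootedBase (p : V → V) (le : V → V → Prop) (τ : V → V) (c : V) : V :=
  if p c = c then τ c else if le c (τ c) then p c else c

open Classical in
/-- The labelings that decrease away from the terminal vertex in each component of a forest and
have their maximum at `τ top`. -/
noncomputable def rerootedLabelings (p : V → V) (le : V → V → Prop) (τ : V → V) (top : V) :
    Finset (Labeling V) :=
  Finset.univ.filter (fun L => ∀ c, ∀ w ∈ rerootedSet p le τ top c, L w ≤ L (rerootedBase p le τ c))

variable {p : V → V} {le : V → V → Prop} {τ : V → V}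

omit [Fintype V] in
lemma IsForestOrder.not_le_parent (h : IsForestOrder p le) {c : V} (hc : p c ≠ c) :
    ¬ le c (p c) := fun h' => hc (h.antisymm _ _ (h.parent_le c) h')

/-- In a component oriented towards its terminal vertex, the far sides of two edges are nested or
disjoint, and the near endpoint of the larger side is outside the smaller one. Together with the
sets of the roots this is a laminar family. -/
theorem card_rerootedLabelings_mul (h : IsForestOrder p le) (hτ : ∀ u w, le u w → τ u = τ w)
    (hτ₂ : ∀ u, τ (τ u) = τ u) (hroot : ∀ c, p c = c → le c (τ c)) (top : V) :
    (rerootedLabelings p le τ top).card * ∏ c, (rerootedSet p le τ top c).card =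
      (Fintype.card V).factorial := by
  classical
  have hτp : ∀ c, τ (p c) = τ c := fun c => hτ _ _ (h.parent_le c)
  have hmem : ∀ c, rerootedBase p le τ c ∈ rerootedSet p le τ top c := by
    intro c
    unfold rerootedBase rerootedSet
    split_ifs with h1 h2 h3
    · simp
    · simp [hτ₂]
    · simp [hτp, h.not_le_parent h1]
    · simp [h.refl]
  have hsub : ∀ c, ¬ (p c = c ∧ c = top) → ∀ w ∈ rerootedSet p le τ top c, τ w = τ c := by
    intro c hc w hw
    unfold rerootedSet at hw
    split_ifs at hw with h1 h2 h3
    · exact absurd ⟨h1, h2⟩ hc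
    · simpa using hw
    · simp only [Finset.mem_filter] at hw
      exact hw.2.1
    · exact (hτ _ _ (by simpa using hw)).symm
  -- Two roots above the same terminal vertex are comparable, and a root has no proper ancestor.
  have hroots : ∀ c c', p c = c → p c' = c' → τ c = τ c' → c = c' := by
    intro c c' hc hc' heq
    by_contra hne
    rcases h.chain _ _ _ (hroot c hc) (heq ▸ hroot c' hc') with h3 | h3
    · exact (h.le_parent _ _ h3 hne).1 hc'
    · exact (h.le_parent _ _ h3 (Ne.symm hne)).1 hc
  have hnmem : ∀ c c', p c = c → c ≠ c' → ¬ (p c' = c' ∧ c' = top) →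
      τ c ∉ rerootedSet p le τ top c' := by
    intro c c' hc hne hc' hmem
    have heq := hsub c' hc' _ hmem
    rw [hτ₂] at heq
    unfold rerootedSet at hmem
    split_ifs at hmem with h1 h2 h3
    · exact hc' ⟨h1, h2⟩
    · exact hne (hroots _ _ hc h1 heq)
    · simp only [Finset.mem_filter, heq] at hmem
      exact hmem.2.2 h3
    · simp only [Finset.mem_filter, heq] at hmem
      exact h3 hmem.2
  -- a root against another vertex
  have hA : ∀ c c', p c = c → c ≠ c' → ¬ (p c' = c' ∧ c' = top) →
      (rerootedSet p le τ top c' ⊆ rerootedSet p le τ top c ∧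
        rerootedBase p le τ c ∉ rerootedSet p le τ top c') ∨
      Disjoint (rerootedSet p le τ top c) (rerootedSet p le τ top c') := by
    intro c c' hc hne hc'
    have hbase : rerootedBase p le τ c = τ c := by simp [rerootedBase, hc]
    rw [hbase]
    by_cases htop : c = top
    · left
      refine ⟨?_, hnmem c c' hc hne hc'⟩
      have : rerootedSet p le τ top c = Finset.univ := by
        unfold rerootedSet
        rw [if_pos hc, if_pos htop]
      rw [this]
      exact Finset.subset_univ _
    · have hS : rerootedSet p le τ top c = Finset.univ.filter (fun w => τ w = τ c) := by
        unfold rerootedSet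
        rw [if_pos hc, if_neg htop]
      by_cases heq : τ c = τ c'
      · left
        refine ⟨fun w hw => ?_, hnmem c c' hc hne hc'⟩
        rw [hS]
        simpa [heq] using hsub c' hc' w hw
      · right
        rw [Finset.disjoint_left]
        intro w hw hw'
        rw [hS] at hw
        have h1 := hsub c' hc' w hw'
        simp only [Finset.mem_filter] at hw
        exact heq (hw.2.symm.trans h1)
  -- two vertices which are not roots
  have hC : ∀ c, p c ≠ c → le c (τ c) → rerootedSet p le τ top c =
      Finset.univ.filter (fun w => τ w = τ c ∧ ¬ le c w) ∧ rerootedBase p le τ c = p c := by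
    intro c h1 h2
    simp [rerootedSet, rerootedBase, h1, h2]
  have hO : ∀ c, p c ≠ c → ¬ le c (τ c) → rerootedSet p le τ top c =
      Finset.univ.filter (fun w => le c w) ∧ rerootedBase p le τ c = c := by
    intro c h1 h2
    simp [rerootedSet, rerootedBase, h1, h2]
  -- Both edges lie on the path from the root to the terminal vertex, so the far sides are
  -- complements of nested subtrees and the inclusion is reversed.
  have hCC : ∀ c c', p c ≠ c → p c' ≠ c' → le c (τ c) → le c' (τ c') → c ≠ c' → τ c = τ c' →
      le c c' → rerootedSet p le τ top c ⊆ rerootedSet p le τ top c' ∧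
        rerootedBase p le τ c' ∉ rerootedSet p le τ top c := by
    intro c c' h1 h2 h3 h4 hne heq hle
    rw [(hC c h1 h3).1, (hC c' h2 h4).1, (hC c' h2 h4).2]
    constructor
    · intro w hw
      simp only [Finset.mem_filter, Finset.mem_univ, true_and] at hw ⊢
      exact ⟨hw.1.trans heq, fun h5 => hw.2 (h.trans _ _ _ hle h5)⟩
    · simp only [Finset.mem_filter, Finset.mem_univ, true_and, not_and, not_not]
      exact fun _ => (h.le_parent _ _ hle hne).2
  have hCO : ∀ c c', p c ≠ c → p c' ≠ c' → le c (τ c) → ¬ le c' (τ c') → τ c = τ c' →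
      (rerootedSet p le τ top c' ⊆ rerootedSet p le τ top c ∧
        rerootedBase p le τ c ∉ rerootedSet p le τ top c') ∨
      Disjoint (rerootedSet p le τ top c) (rerootedSet p le τ top c') := by
    intro c c' h1 h2 h3 h4 heq
    rw [(hC c h1 h3).1, (hO c' h2 h4).1, (hC c h1 h3).2]
    by_cases hle : le c c'
    · right
      rw [Finset.disjoint_left]
      intro w hw hw'
      simp only [Finset.mem_filter, Finset.mem_univ, true_and] at hw hw'
      exact hw.2 (h.trans _ _ _ hle hw')
    · left
      constructor
      · intro w hw
        simp only [Finset.mem_filter, Finset.mem_univ, true_and] at hw ⊢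
        refine ⟨(hτ _ _ hw).symm.trans heq.symm, fun h5 => ?_⟩
        rcases h.chain _ _ _ hw h5 with h6 | h6
        · exact h4 (heq ▸ h.trans _ _ _ h6 h3)
        · exact hle h6
      · simp only [Finset.mem_filter, Finset.mem_univ, true_and]
        exact fun h5 => h4 (heq ▸ h.trans _ _ _ (h.trans _ _ _ h5 (h.parent_le c)) h3)
  have hOO : ∀ c c', p c ≠ c → p c' ≠ c' → ¬ le c (τ c) → ¬ le c' (τ c') → c ≠ c' →
      le c c' → rerootedSet p le τ top c' ⊆ rerootedSet p le τ top c ∧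
        rerootedBase p le τ c ∉ rerootedSet p le τ top c' := by
    intro c c' h1 h2 h3 h4 hne hle
    rw [(hO c h1 h3).1, (hO c' h2 h4).1, (hO c h1 h3).2]
    constructor
    · intro w hw
      simp only [Finset.mem_filter, Finset.mem_univ, true_and] at hw ⊢
      exact h.trans _ _ _ hle hw
    · simp only [Finset.mem_filter, Finset.mem_univ, true_and]
      exact fun h5 => hne (h.antisymm _ _ hle h5)
  have := card_labelings_mul_prod_card Finset.univ (rerootedBase p le τ) (rerootedSet p le τ top)
    (fun c _ => hmem c) ?_
  · rw [← this, rerootedLabelings]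
    congr 2
    ext L
    simp
  intro c _ c' _ hne
  by_cases h1 : p c = c <;> by_cases h2 : p c' = c'
  · by_cases ht : c' = top
    · rcases hA c' c h2 hne.symm (fun h => hne (h.2.trans ht.symm)) with h5 | h5
      · exact Or.inl h5
      · exact Or.inr (Or.inr h5.symm)
    · exact Or.inr (hA c c' h1 hne (fun h => ht h.2))
  · exact Or.inr (hA c c' h1 hne (fun h => h2 h.1))
  · rcases hA c' c h2 hne.symm (fun h => h1 h.1) with h5 | h5
    · exact Or.inl h5
    · exact Or.inr (Or.inr h5.symm)
  · by_cases heq : τ c = τ c'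
    · by_cases h3 : le c (τ c) <;> by_cases h4 : le c' (τ c')
      · rcases h.chain _ _ _ h3 (heq ▸ h4) with h5 | h5
        · exact Or.inl (hCC c c' h1 h2 h3 h4 hne heq h5)
        · exact Or.inr (Or.inl (hCC c' c h2 h1 h4 h3 hne.symm heq.symm h5))
      · exact Or.inr (hCO c c' h1 h2 h3 h4 heq)
      · rcases hCO c' c h2 h1 h4 h3 heq.symm with h5 | h5
        · exact Or.inl h5
        · exact Or.inr (Or.inr h5.symm)
      · by_cases h5 : le c c'
        · exact Or.inr (Or.inl (hOO c c' h1 h2 h3 h4 hne h5))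
        · by_cases h6 : le c' c
          · exact Or.inl (hOO c' c h2 h1 h4 h3 hne.symm h6)
          · refine Or.inr (Or.inr ?_)
            rw [(hO c h1 h3).1, (hO c' h2 h4).1, Finset.disjoint_left]
            intro w hw hw'
            simp only [Finset.mem_filter, Finset.mem_univ, true_and] at hw hw'
            rcases h.chain _ _ _ hw hw' with h7 | h7
            · exact h5 h7
            · exact h6 h7
    · refine Or.inr (Or.inr (Finset.disjoint_left.2 fun w hw hw' => heq ?_))
      exact (hsub c (fun h => h1 h.1) w hw).symm.trans (hsub c' (fun h => h2 h.1) w hw')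

end Forest

/-! ### Parent maps and ancestors in a rooted tree. -/

section ParentMap

variable {V : Type u} {G : SimpleGraph V} {r : V} {p : V → V}

/-- `p` is the parent map of the tree `G` rooted at `r`. -/
structure IsParentMap (G : SimpleGraph V) (r : V) (p : V → V) : Prop where
  parent_root : p r = r
  dist_parent : ∀ v, v ≠ r → G.dist r (p v) + 1 = G.dist r v
  adj_iff : ∀ u v, G.Adj u v ↔ (u ≠ r ∧ p u = v) ∨ (v ≠ r ∧ p v = u)

/-- Shortest walks to `u` and to `w`, extended by the edge to `v`, are both paths from `r` to `v`;
paths in a tree are unique, so the last edges agree. -/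
lemma SimpleGraph.IsTree.eq_of_adj_of_dist_lt (hG : G.IsTree) {u v w : V} (hu : G.Adj u v)
    (hw : G.Adj w v) (hu' : G.dist r v = G.dist r u + 1) (hw' : G.dist r v = G.dist r w + 1) :
    u = w := by
  obtain ⟨P, hP⟩ := hG.connected.exists_walk_length_eq_dist r u
  obtain ⟨Q, hQ⟩ := hG.connected.exists_walk_length_eq_dist r w
  have h1 := (P.concat hu).isPath_of_length_eq_dist (by simp [hP, hu'])
  have h2 := (Q.concat hw).isPath_of_length_eq_dist (by simp [hQ, hw'])
  obtain ⟨h, _⟩ := SimpleGraph.Walk.concat_inj ((hG.existsUnique_path r v).unique h1 h2)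
  exact h

theorem SimpleGraph.IsTree.exists_isParentMap (hG : G.IsTree) (r : V) :
    ∃ p, IsParentMap G r p := by
  classical
  have hex : ∀ v, v ≠ r → ∃ w, G.Adj w v ∧ G.dist r v = G.dist r w + 1 := by
    intro v hv
    obtain ⟨P, hP⟩ := hG.connected.exists_walk_length_eq_dist r v
    obtain ⟨w, Q, h, rfl⟩ : ∃ (w : V) (Q : G.Walk r w) (h : G.Adj w v), P = Q.concat h := by
      induction P using SimpleGraph.Walk.concatRec with
      | Hnil => exact absurd rfl hv
      | Hconcat Q h _ => exact ⟨_, Q, h, rfl⟩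
    refine ⟨w, h, ?_⟩
    have h1 := SimpleGraph.dist_le Q
    rcases hG.dist_eq_dist_add_one_of_adj r h with h2 | h2
    · simp at hP
      omega
    · exact h2
  choose! f hf using hex
  refine ⟨fun v => if v = r then r else f v, by simp, ?_, ?_⟩
  · intro v hv
    simp [hv, (hf v hv).2]
  · intro u v
    constructor
    · intro h
      rcases hG.dist_eq_dist_add_one_of_adj r h with h2 | h2
      · left
        have hu : u ≠ r := by
          rintro rfl
          simp at h2
        refine ⟨hu, ?_⟩
        rw [if_neg hu]
        exact hG.eq_of_adj_of_dist_lt (hf u hu).1 h.symm (hf u hu).2 h2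
      · right
        have hv : v ≠ r := by
          rintro rfl
          simp at h2
        refine ⟨hv, ?_⟩
        rw [if_neg hv]
        exact hG.eq_of_adj_of_dist_lt (hf v hv).1 h (hf v hv).2 h2
    · rintro (⟨h1, h2⟩ | ⟨h1, h2⟩)
      · rw [if_neg h1] at h2
        exact h2 ▸ (hf u h1).1.symm
      · rw [if_neg h1] at h2
        exact h2 ▸ (hf v h1).1

/-- `u` is an ancestor of `w` (or `w` itself) with respect to the parent map `p`. -/
def IsAncestor (p : V → V) (u w : V) : Prop := ∃ i : ℕ, p^[i] w = u

lemma IsAncestor.refl (p : V → V) (v : V) : IsAncestor p v v := ⟨0, rfl⟩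

lemma IsAncestor.trans {u v w : V} (h1 : IsAncestor p u v) (h2 : IsAncestor p v w) :
    IsAncestor p u w := by
  obtain ⟨i, rfl⟩ := h1
  obtain ⟨j, rfl⟩ := h2
  exact ⟨i + j, Function.iterate_add_apply p i j w⟩

lemma isAncestor_parent (p : V → V) (v : V) : IsAncestor p (p v) v := ⟨1, rfl⟩

lemma IsAncestor.of_ne {u w : V} (h : IsAncestor p u w) (hne : u ≠ w) : IsAncestor p u (p w) := by
  obtain ⟨i, hi⟩ := h
  cases i with
  | zero => exact absurd hi.symm hne
  | succ i => exact ⟨i, hi⟩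

lemma IsAncestor.chain {u v w : V} (h1 : IsAncestor p u w) (h2 : IsAncestor p v w) :
    IsAncestor p u v ∨ IsAncestor p v u := by
  obtain ⟨i, rfl⟩ := h1
  obtain ⟨j, rfl⟩ := h2
  rcases le_total i j with h | h
  · right
    exact ⟨j - i, by rw [← Function.iterate_add_apply, Nat.sub_add_cancel h]⟩
  · left
    exact ⟨i - j, by rw [← Function.iterate_add_apply, Nat.sub_add_cancel h]⟩

namespace IsParentMap

variable (H : IsParentMap G r p)
include H

lemma parent_ne {v : V} (hv : v ≠ r) : p v ≠ v := by
  intro h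
  have := H.dist_parent v hv
  rw [h] at this
  omega

lemma eq_root_of_dist {v : V} (hv : G.dist r v = 0) : v = r := by
  by_contra h
  have := H.dist_parent v h
  omega

lemma dist_iterate (v : V) (i : ℕ) : G.dist r (p^[i] v) = G.dist r v - i := by
  induction i with
  | zero => rfl
  | succ i ih =>
    rw [Function.iterate_succ_apply']
    by_cases h : p^[i] v = r
    · rw [h, H.parent_root]
      rw [h] at ih
      simp at ih ⊢
      omega
    · have := H.dist_parent _ h
      omega

lemma dist_le_of_isAncestor {u w : V} (h : IsAncestor p u w) : G.dist r u ≤ G.dist r w := by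
  obtain ⟨i, rfl⟩ := h
  rw [H.dist_iterate]
  omega

lemma eq_of_isAncestor_of_dist_eq {u w : V} (h : IsAncestor p u w)
    (hd : G.dist r u = G.dist r w) : u = w := by
  by_contra hne
  have h1 := H.dist_le_of_isAncestor (h.of_ne hne)
  by_cases hw : w = r
  · subst hw
    rw [SimpleGraph.dist_self] at hd
    exact hne (H.eq_root_of_dist hd)
  · have := H.dist_parent w hw
    omega

lemma dist_lt_of_isAncestor {u w : V} (h : IsAncestor p u w) (hne : u ≠ w) :
    G.dist r u < G.dist r w :=
  lt_of_le_of_ne (H.dist_le_of_isAncestor h) fun hd => hne (H.eq_of_isAncestor_of_dist_eq h hd)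

lemma antisymm {u w : V} (h1 : IsAncestor p u w) (h2 : IsAncestor p w u) : u = w :=
  H.eq_of_isAncestor_of_dist_eq h1
    (le_antisymm (H.dist_le_of_isAncestor h1) (H.dist_le_of_isAncestor h2))

lemma isAncestor_root (v : V) : IsAncestor p r v :=
  ⟨G.dist r v, H.eq_root_of_dist (by rw [H.dist_iterate]; omega)⟩

lemma eq_root_of_isAncestor {v : V} (h : IsAncestor p v r) : v = r :=
  H.antisymm h (H.isAncestor_root v)

lemma isForestOrder : IsForestOrder p (IsAncestor p) where
  refl := IsAncestor.refl p
  trans _ _ _ := IsAncestor.trans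
  antisymm _ _ := H.antisymm
  chain _ _ _ := IsAncestor.chain
  parent_le := isAncestor_parent p
  le_parent u w h hne := by
    refine ⟨H.parent_ne ?_, h.of_ne hne⟩
    rintro rfl
    exact hne (H.eq_root_of_isAncestor h)

variable [Fintype V]

-- There is exactly one ancestor in each generation from 1 to that of `v`; this turns sums and
-- products over non-root ancestors into ones over `Finset.range`, with the generation shifted by
-- one.
open Classical in
lemma image_dist_ancestors (v : V) :
    (Finset.univ.filter (fun c => IsAncestor p c v ∧ c ≠ r)).image (G.dist r) =
      (Finset.range (G.dist r v)).image (· + 1) := by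
  ext j
  simp only [Finset.mem_image, Finset.mem_filter, Finset.mem_univ, true_and, Finset.mem_range]
  constructor
  · rintro ⟨c, ⟨h1, h2⟩, rfl⟩
    have h3 := H.dist_le_of_isAncestor h1
    have h4 : G.dist r c ≠ 0 := fun h => h2 (H.eq_root_of_dist h)
    exact ⟨G.dist r c - 1, by omega, by omega⟩
  · rintro ⟨i, hi, rfl⟩
    have h1 : G.dist r (p^[G.dist r v - (i + 1)] v) = i + 1 := by
      rw [H.dist_iterate]
      omega
    refine ⟨_, ⟨⟨_, rfl⟩, ?_⟩, h1⟩
    intro h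
    rw [h] at h1
    simp at h1

omit [Fintype V] in
lemma injOn_dist_ancestors (v : V) : Set.InjOn (G.dist r) {c | IsAncestor p c v ∧ c ≠ r} := by
  intro c hc c' hc' h
  rcases hc.1.chain hc'.1 with h1 | h1
  · exact H.eq_of_isAncestor_of_dist_eq h1 h
  · exact (H.eq_of_isAncestor_of_dist_eq h1 h.symm).symm

open Classical in
lemma sum_ancestors (v : V) (f : ℕ → ℝ) :
    ∑ c ∈ Finset.univ.filter (fun c => IsAncestor p c v ∧ c ≠ r), f (G.dist r c) =
      ∑ j ∈ Finset.range (G.dist r v), f (j + 1) := by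
  rw [← Finset.sum_image (f := f) (g := G.dist r), H.image_dist_ancestors v, Finset.sum_image]
  · simp
  · simpa using H.injOn_dist_ancestors v

open Classical in
lemma prod_ancestors (v : V) (f : ℕ → ℝ) :
    ∏ c, (if IsAncestor p c v ∧ c ≠ r then f (G.dist r c) else 1) =
      ∏ j ∈ Finset.range (G.dist r v), f (j + 1) := by
  rw [← Finset.prod_filter, ← Finset.prod_image (f := f) (g := G.dist r), H.image_dist_ancestors v,
    Finset.prod_image]
  · simp
  · simpa using H.injOn_dist_ancestors v

end IsParentMap

end ParentMap

/-! ### Deleting one edge, and the pigeonhole argument. -/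

section Cut

variable {V : Type u} {G : SimpleGraph V} {r : V} {p : V → V}

open Classical in
/-- The parent map of the forest obtained by deleting the edge between `q` and its parent. -/
noncomputable def cutParent (p : V → V) (q : V) : V → V := Function.update p q q

/-- The ancestor order of the forest obtained by deleting the edge between `q` and its parent. -/
def cutLE (p : V → V) (q u w : V) : Prop := IsAncestor p u w ∧ (IsAncestor p q u ↔ IsAncestor p q w)

open Classical in
/-- The terminal vertices of the forest obtained by deleting the edge between `q` and its parent. -/
noncomputable def cutTerminal (p : V → V) (q a b w : V) : V := if IsAncestor p q w then b else a

lemma cutTerminal_eq_of_cutLE {q u w : V} (h : cutLE p q u w) (a b : V) :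
    cutTerminal p q a b u = cutTerminal p q a b w := by
  have := h.2
  unfold cutTerminal
  by_cases hu : IsAncestor p q u <;> simp_all

lemma cutParent_self (p : V → V) (q : V) : cutParent p q q = q := by simp [cutParent]

lemma cutParent_of_ne (p : V → V) {q v : V} (h : v ≠ q) : cutParent p q v = p v := by
  simp [cutParent, h]

lemma isAncestor_parent_iff {q v : V} (h : v ≠ q) : IsAncestor p q (p v) ↔ IsAncestor p q v :=
  ⟨fun h' => h'.trans (isAncestor_parent p v), fun h' => h'.of_ne h.symm⟩

lemma isAncestor_cutParent_iff {q v : V} :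
    IsAncestor p q (cutParent p q v) ↔ IsAncestor p q v := by
  by_cases h : v = q
  · rw [h, cutParent_self]
  · rw [cutParent_of_ne p h, isAncestor_parent_iff h]

lemma IsParentMap.cut_isForestOrder (H : IsParentMap G r p) (q : V) :
    IsForestOrder (cutParent p q) (cutLE p q) where
  refl v := ⟨IsAncestor.refl p v, Iff.rfl⟩
  trans u v w h1 h2 := ⟨h1.1.trans h2.1, h1.2.trans h2.2⟩
  antisymm u v h1 h2 := H.antisymm h1.1 h2.1
  chain u v w h1 h2 := by
    rcases h1.1.chain h2.1 with h | h
    · exact Or.inl ⟨h, h1.2.trans h2.2.symm⟩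
    · exact Or.inr ⟨h, h2.2.trans h1.2.symm⟩
  parent_le v := by
    refine ⟨?_, isAncestor_cutParent_iff⟩
    by_cases h : v = q
    · rw [h, cutParent_self]
      exact IsAncestor.refl p q
    · rw [cutParent_of_ne p h]
      exact isAncestor_parent p v
  le_parent u w h hne := by
    have hw : w ≠ q := by
      rintro rfl
      exact hne (H.antisymm h.1 (h.2.2 (IsAncestor.refl p w)))
    refine ⟨?_, ?_, h.2.trans isAncestor_cutParent_iff.symm⟩
    · rw [cutParent_of_ne p hw]
      refine H.parent_ne ?_
      rintro rfl
      exact hne (H.eq_root_of_isAncestor h.1)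
    · rw [cutParent_of_ne p hw]
      exact h.1.of_ne hne

variable [Fintype V]

/-- The labelings which, after deletion of the edge between `q` and its parent, decrease away from
`a` and from `b` in the two components, the maximum being in the component with root `top`. -/
noncomputable def cutLabelings (p : V → V) (q a b top : V) : Finset (Labeling V) :=
  rerootedLabelings (cutParent p q) (cutLE p q) (cutTerminal p q a b) top

/-- The labelings that decrease away from the root. -/
noncomputable def rootedLabelings (p : V → V) (r : V) : Finset (Labeling V) :=
  rerootedLabelings p (IsAncestor p) (fun _ => r) r

open Classical in
/-- The descendants of `v`, including `v`. -/
noncomputable def descendants (p : V → V) (v : V) : Finset V :=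
  Finset.univ.filter (fun w => IsAncestor p v w)

namespace IsParentMap

variable (H : IsParentMap G r p)
include H

theorem card_cutLabelings_mul {q a b : V} (hq : q ≠ r) (ha : ¬ IsAncestor p q a)
    (hb : IsAncestor p q b) (top : V) :
    (cutLabelings p q a b top).card *
      ∏ c, (rerootedSet (cutParent p q) (cutLE p q) (cutTerminal p q a b) top c).card =
      (Fintype.card V).factorial := by
  refine card_rerootedLabelings_mul (H.cut_isForestOrder q) ?_ ?_ ?_ top
  · exact fun u w h => cutTerminal_eq_of_cutLE h a b
  · intro u
    simp only [cutTerminal]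
    split_ifs <;> simp_all
  · intro c hc
    by_cases hcq : c = q
    · subst hcq
      simp [cutTerminal, cutLE, IsAncestor.refl, hb]
    · have hcr : c = r := by
        by_contra h
        rw [cutParent_of_ne p hcq] at hc
        exact H.parent_ne h hc
      subst hcr
      have : ¬ IsAncestor p q c := fun h => hq (H.eq_root_of_isAncestor h)
      simp [cutTerminal, cutLE, this, ha, H.isAncestor_root]

lemma rerootedSet_root (c : V) :
    rerootedSet p (IsAncestor p) (fun _ => r) r c = descendants p c := by
  classical
  unfold rerootedSet descendants
  split_ifs with h1 h2 h3
  · subst h2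
    simp [H.isAncestor_root]
  · exact absurd h1 (H.parent_ne h2)
  · have := H.eq_root_of_isAncestor h3
    subst this
    exact absurd H.parent_root h1
  · rfl

omit [Fintype V] in
lemma rerootedBase_root (c : V) : rerootedBase p (IsAncestor p) (fun _ => r) c = c := by
  classical
  unfold rerootedBase
  split_ifs with h1 h2
  · by_contra h
    exact H.parent_ne (Ne.symm h) h1
  · have := H.eq_root_of_isAncestor h2
    subst this
    exact absurd H.parent_root h1
  · rfl

theorem card_rootedLabelings_mul :
    (rootedLabelings p r).card * ∏ c, (descendants p c).card = (Fintype.card V).factorial := by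
  rw [← card_rerootedLabelings_mul H.isForestOrder (τ := fun _ => r) (fun _ _ _ => rfl)
    (fun _ => rfl) (fun c _ => ?_) r]
  · simp only [H.rerootedSet_root]
    rfl
  · by_cases h : c = r
    · subst h
      exact IsAncestor.refl p c
    · exact absurd ‹p c = c› (H.parent_ne h)

lemma mem_rootedLabelings {L : Labeling V} (hL : ∀ v, L v ≤ L (p v)) :
    L ∈ rootedLabelings p r := by
  classical
  simp only [rootedLabelings, rerootedLabelings, Finset.mem_filter, Finset.mem_univ, true_and,
    H.rerootedSet_root, H.rerootedBase_root, descendants]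
  rintro c w ⟨i, rfl⟩
  induction i with
  | zero => exact le_rfl
  | succ i ih =>
    rw [Function.iterate_succ_apply']
    exact ih.trans (hL _)

end IsParentMap

/-- `L` does not have a local maximum at `v` in the forest with parent map `p`. -/
def HasHigherNeighbor (p : V → V) (L : Labeling V) (v : V) : Prop :=
  ∃ w, L v < L w ∧ (p v = w ∨ p w = v)

/-- The vertex with the highest label in a union of components has no higher neighbour. Applied to
each side of a deleted edge, it locates a peak there. -/
lemma exists_not_hasHigherNeighbor (L : Labeling V) (P : V → Prop) (hP : ∀ v, P (p v) ↔ P v)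
    {v : V} (hv : P v) : ∃ w, P w ∧ ¬ HasHigherNeighbor p L w := by
  classical
  obtain ⟨w, hw, hmax⟩ := Finset.exists_max_image (Finset.univ.filter P) L ⟨v, by simpa using hv⟩
  simp only [Finset.mem_filter, Finset.mem_univ, true_and] at hw hmax
  refine ⟨w, hw, ?_⟩
  rintro ⟨x, hx, rfl | rfl⟩
  · exact absurd (hmax _ ((hP w).2 hw)) (not_le.2 hx)
  · exact absurd (hmax _ ((hP x).1 hw)) (not_le.2 hx)

lemma mem_rerootedLabelings {le : V → V → Prop} {τ : V → V} {top : V} {L : Labeling V}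
    (h : IsForestOrder p le) (hτ : ∀ u w, le u w → τ u = τ w)
    (hup : ∀ v, τ v ≠ v → HasHigherNeighbor p L v) (htop : ∀ v, L (τ v) ≤ L (τ top)) :
    L ∈ rerootedLabelings p le τ top := by
  classical
  -- Local to global: if every vertex of `D` other than `β` has all its forest neighbours in `D` and
  -- is not terminal, then its higher neighbour prevents it from being the maximum of `D`.
  have hmax : ∀ (D : Finset V) (β : V),
      (∀ w ∈ D, w ≠ β → τ w ≠ w ∧ (p w ∈ D) ∧ ∀ x, p x = w → x ∈ D) → ∀ w ∈ D, L w ≤ L β := by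
    intro D β hD w hw
    obtain ⟨m, hm, hm'⟩ := Finset.exists_max_image D L ⟨w, hw⟩
    by_cases hmβ : m = β
    · exact hmβ ▸ hm' w hw
    · obtain ⟨h1, h2, h3⟩ := hD m hm hmβ
      obtain ⟨x, hx, rfl | hx'⟩ := hup m h1
      · exact absurd (hm' _ h2) (not_le.2 hx)
      · exact absurd (hm' _ (h3 x hx')) (not_le.2 hx)
  have hτp : ∀ c, τ (p c) = τ c := fun c => hτ _ _ (h.parent_le c)
  have hcomp : ∀ c w, τ w = τ c → L w ≤ L (τ c) := by
    intro c w hw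
    refine hmax (Finset.univ.filter (fun w => τ w = τ c)) (τ c) ?_ w (by simpa using hw)
    intro w hw hne
    simp only [Finset.mem_filter, Finset.mem_univ, true_and] at hw ⊢
    refine ⟨fun h => hne (h.symm.trans hw), by rw [hτp, hw], ?_⟩
    rintro x rfl
    rw [← hτp, hw]
  simp only [rerootedLabelings, Finset.mem_filter, Finset.mem_univ, true_and]
  intro c
  unfold rerootedSet rerootedBase
  split_ifs with h1 h2 h3
  · subst h2
    exact fun w _ => (hcomp w w rfl).trans (htop w)
  · intro w hw
    exact hcomp c w (by simpa using hw)
  · apply hmax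
    intro w hw hne
    simp only [Finset.mem_filter, Finset.mem_univ, true_and] at hw ⊢
    refine ⟨fun h' => hw.2 ?_, ⟨by rw [hτp, hw.1], fun h' => hw.2 (h.trans _ _ _ h' (h.parent_le w))⟩,
      ?_⟩
    · rw [← h', hw.1]
      exact h3
    · rintro x rfl
      refine ⟨by rw [← hτp, hw.1], fun h' => hw.2 ?_⟩
      refine (h.le_parent _ _ h' ?_).2
      rintro rfl
      exact hne rfl
  · apply hmax
    intro w hw hne
    simp only [Finset.mem_filter, Finset.mem_univ, true_and] at hw ⊢
    refine ⟨fun h' => h3 ?_, (h.le_parent _ _ hw hne.symm).2, ?_⟩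
    · rw [hτ _ _ hw, h']
      exact hw
    · rintro x rfl
      exact h.trans _ _ _ hw (h.parent_le x)

open Classical in
/-- The labelings with exactly two peaks, `x` being the higher and `y` the lower one. -/
noncomputable def twinLabelings (G : SimpleGraph V) (x y : V) : Finset (Labeling V) :=
  Finset.univ.filter (fun L => L y < L x ∧ ∀ v, IsPeak G L v ↔ v = x ∨ v = y)

lemma mem_twinLabelings {x y : V} {L : Labeling V} :
    L ∈ twinLabelings G x y ↔ L y < L x ∧ ∀ v, IsPeak G L v ↔ v = x ∨ v = y := by
  simp [twinLabelings]

open Classical in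
/-- The endpoint with the smaller label of the edge between `q` and its parent. -/
noncomputable def lowerEnd (p : V → V) (L : Labeling V) (q : V) : V :=
  if L q < L (p q) then q else p q

namespace IsParentMap

variable (H : IsParentMap G r p)
include H

lemma not_isPeak_lowerEnd (L : Labeling V) {q : V} (hq : q ≠ r) :
    ¬ IsPeak G L (lowerEnd p L q) := by
  intro h
  unfold lowerEnd at h
  split_ifs at h with h1
  · exact absurd (h _ ((H.adj_iff _ _).2 (Or.inl ⟨hq, rfl⟩))) (not_lt.2 h1.le)
  · exact h1 (h _ ((H.adj_iff _ _).2 (Or.inr ⟨hq, rfl⟩)))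

/-- Pigeonhole: the edges correspond to the vertices `q ≠ r`, one more than there are vertices that
are not peaks, and a lower end is never a peak. -/
lemma exists_lowerEnd_eq {x y : V} {L : Labeling V} (hL : L ∈ twinLabelings G x y) :
    ∃ q₁ q₂, q₁ ≠ q₂ ∧ q₁ ≠ r ∧ q₂ ≠ r ∧ lowerEnd p L q₁ = lowerEnd p L q₂ := by
  classical
  rw [mem_twinLabelings] at hL
  have hxy : x ≠ y := by
    rintro rfl
    exact lt_irrefl _ hL.1
  have hcard : ((Finset.univ.erase x).erase y).card < (Finset.univ.erase r).card := by
    rw [Finset.card_erase_of_mem (by simp [hxy.symm]), Finset.card_erase_of_mem (by simp),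
      Finset.card_erase_of_mem (by simp)]
    have : 1 < Fintype.card V := Fintype.one_lt_card_iff.2 ⟨x, y, hxy⟩
    rw [Finset.card_univ]
    omega
  obtain ⟨q₁, h1, q₂, h2, hne, heq⟩ := Finset.exists_ne_map_eq_of_card_lt_of_maps_to hcard
    (f := lowerEnd p L) (by
      intro q hq
      have := H.not_isPeak_lowerEnd L (q := q) (by simpa using hq)
      rw [hL.2] at this
      push Not at this
      simp [this.1, this.2])
  exact ⟨q₁, q₂, hne, by simpa using h1, by simpa using h2, heq⟩

/-- A vertex that is not a peak is the lower end of some edge. If this edge is the deleted one, the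
edge of `q'` has the same lower end and takes its place. -/
lemma hasHigherNeighbor_cutParent {x y : V} {L : Labeling V} (hL : L ∈ twinLabelings G x y)
    {q q' : V} (hne : q' ≠ q) (hq' : q' ≠ r) (heq : lowerEnd p L q = lowerEnd p L q') {v : V}
    (hvx : v ≠ x) (hvy : v ≠ y) : HasHigherNeighbor (cutParent p q) L v := by
  classical
  have hlow : ∀ c, c ≠ q → c ≠ r → HasHigherNeighbor (cutParent p q) L (lowerEnd p L c) := by
    intro c hc hcr
    unfold lowerEnd
    split_ifs with h1
    · exact ⟨p c, h1, Or.inl (cutParent_of_ne p hc)⟩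
    · refine ⟨c, lt_of_le_of_ne (not_lt.1 h1) fun h => ?_, Or.inr (cutParent_of_ne p hc)⟩
      exact H.parent_ne hcr (L.injective h)
  rw [mem_twinLabelings] at hL
  have hnp : ¬ IsPeak G L v := by
    rw [hL.2]
    simp [hvx, hvy]
  obtain ⟨c, hcr, rfl⟩ : ∃ c, c ≠ r ∧ v = lowerEnd p L c := by
    unfold IsPeak at hnp
    push Not at hnp
    obtain ⟨w, hadj, hw⟩ := hnp
    rcases (H.adj_iff _ _).1 hadj with ⟨h1, rfl⟩ | ⟨h1, rfl⟩
    · refine ⟨v, h1, ?_⟩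
      rw [lowerEnd, if_pos]
      exact lt_of_le_of_ne hw fun h => H.parent_ne h1 (L.injective h).symm
    · exact ⟨w, h1, by rw [lowerEnd, if_neg (not_lt.2 hw)]⟩
  by_cases hcq : c = q
  · rw [hcq, heq]
    exact hlow q' hne hq'
  · exact hlow c hcq hcr

/-- Each component contains a vertex without a higher neighbour in the forest, which can only be `x`
or `y`; so the deleted edge separates the peaks. The component of `x` is the one with the overall
maximum, which fixes the last argument of `cutLabelings`. -/
lemma mem_cutLabelings_of_twin {x y : V} {L : Labeling V} (hL : L ∈ twinLabelings G x y)
    {q q' : V} (hq : q ≠ r) (hne : q' ≠ q) (hq' : q' ≠ r)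
    (heq : lowerEnd p L q = lowerEnd p L q') :
    (IsAncestor p q y ∧ ¬ IsAncestor p q x ∧ L ∈ cutLabelings p q x y r) ∨
    (IsAncestor p q x ∧ ¬ IsAncestor p q y ∧ L ∈ cutLabelings p q y x q) := by
  have hup : ∀ v, v ≠ x → v ≠ y → HasHigherNeighbor (cutParent p q) L v :=
    fun v => H.hasHigherNeighbor_cutParent hL hne hq' heq
  have h1 : IsAncestor p q x ∨ IsAncestor p q y := by
    obtain ⟨w, hw, hw'⟩ := exists_not_hasHigherNeighbor (p := cutParent p q) L (IsAncestor p q)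
      (fun v => isAncestor_cutParent_iff) (IsAncestor.refl p q)
    by_cases hx : w = x
    · exact Or.inl (hx ▸ hw)
    · by_cases hy : w = y
      · exact Or.inr (hy ▸ hw)
      · exact absurd (hup w hx hy) hw'
  have hqr : ¬ IsAncestor p q r := fun h => hq (H.eq_root_of_isAncestor h)
  have h2 : ¬ IsAncestor p q x ∨ ¬ IsAncestor p q y := by
    obtain ⟨w, hw, hw'⟩ := exists_not_hasHigherNeighbor (p := cutParent p q) L
      (fun v => ¬ IsAncestor p q v) (fun v => not_congr isAncestor_cutParent_iff) hqr
    by_cases hx : w = x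
    · exact Or.inl (hx ▸ hw)
    · by_cases hy : w = y
      · exact Or.inr (hy ▸ hw)
      · exact absurd (hup w hx hy) hw'
  rw [mem_twinLabelings] at hL
  have key : ∀ a b top, ¬ IsAncestor p q a → IsAncestor p q b →
      (∀ v, v ≠ a → v ≠ b → HasHigherNeighbor (cutParent p q) L v) →
      (∀ v, L (cutTerminal p q a b v) ≤ L (cutTerminal p q a b top)) →
      L ∈ cutLabelings p q a b top := by
    intro a b top ha hb hup' htop
    refine mem_rerootedLabelings (H.cut_isForestOrder q) ?_ ?_ htop
    · exact fun u w h => cutTerminal_eq_of_cutLE h a b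
    · intro v hv
      refine hup' v ?_ ?_
      · rintro rfl
        simp [cutTerminal, ha] at hv
      · rintro rfl
        simp [cutTerminal, hb] at hv
  by_cases hx : IsAncestor p q x
  · have hy := h2.resolve_left (not_not.2 hx)
    refine Or.inr ⟨hx, hy, key y x q hy hx (fun v h h' => hup v h' h) fun v => ?_⟩
    simp only [cutTerminal, IsAncestor.refl, if_true]
    split_ifs
    · exact le_rfl
    · exact hL.1.le
  · have hy := h1.resolve_left hx
    refine Or.inl ⟨hy, hx, key x y r hx hy hup fun v => ?_⟩
    simp only [cutTerminal, hqr, if_false]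
    split_ifs
    · exact hL.1.le
    · exact le_rfl

open Classical in
/-- Every labeling with exactly two peaks is counted at least twice when the trees obtained by
deleting an edge between the peaks are considered. -/
theorem two_mul_card_twinLabelings_le (x y : V) :
    2 * (twinLabelings G x y).card ≤
      ∑ q ∈ Finset.univ.filter (fun q => IsAncestor p q y ∧ q ≠ r),
        (if IsAncestor p q x then 0 else (cutLabelings p q x y r).card) +
      ∑ q ∈ Finset.univ.filter (fun q => IsAncestor p q x ∧ q ≠ r),
        (if IsAncestor p q y then 0 else (cutLabelings p q y x q).card) := by
  let R : V → Labeling V → Prop := fun q L => q ≠ r ∧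
    ((IsAncestor p q y ∧ ¬ IsAncestor p q x ∧ L ∈ cutLabelings p q x y r) ∨
    (IsAncestor p q x ∧ ¬ IsAncestor p q y ∧ L ∈ cutLabelings p q y x q))
  -- Double counting of pairs of an edge and a labeling: both edges from the pigeonhole argument are
  -- related to the labeling.
  have h1 : 2 * (twinLabelings G x y).card ≤
      ∑ L ∈ twinLabelings G x y, (Finset.univ.bipartiteBelow R L).card := by
    rw [mul_comm, ← smul_eq_mul]
    refine Finset.card_nsmul_le_sum _ _ _ fun L hL => ?_
    obtain ⟨q₁, q₂, hne, hq₁, hq₂, heq⟩ := H.exists_lowerEnd_eq hL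
    rw [← Finset.card_pair hne]
    refine Finset.card_le_card ?_
    intro q hq
    simp only [Finset.mem_insert, Finset.mem_singleton] at hq
    simp only [Finset.bipartiteBelow, Finset.mem_filter, Finset.mem_univ, true_and]
    rcases hq with rfl | rfl
    · exact ⟨hq₁, H.mem_cutLabelings_of_twin hL hq₁ hne.symm hq₂ heq⟩
    · exact ⟨hq₂, H.mem_cutLabelings_of_twin hL hq₂ hne hq₁ heq.symm⟩
  refine h1.trans ?_
  rw [← Finset.sum_card_bipartiteAbove_eq_sum_card_bipartiteBelow, Finset.sum_filter,
    Finset.sum_filter, ← Finset.sum_add_distrib]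
  refine Finset.sum_le_sum fun q _ => ?_
  unfold Finset.bipartiteAbove
  by_cases hq : q = r
  · simp [R, hq]
  · by_cases hx : IsAncestor p q x <;> by_cases hy : IsAncestor p q y
    · simp [R, hx, hy]
    · simp only [hx, hy, hq, ne_eq, not_false_eq_true, and_true, and_self, if_true, if_false,
        zero_add]
      refine Finset.card_le_card fun L hL => ?_
      simp only [R, Finset.mem_filter] at hL
      tauto
    · simp only [hx, hy, hq, ne_eq, not_false_eq_true, and_true, and_self, if_true, if_false,
        add_zero]
      refine Finset.card_le_card fun L hL => ?_
      simp only [R, Finset.mem_filter] at hL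
      tauto
    · simp [R, hx, hy]

/-- When the deleted edge is put back, either `p q` has the smaller label and `q` is a second peak,
or `q` has the smaller label and the labeling decreases away from the root everywhere. -/
theorem card_cutLabelings_le (q : V) (hq : q ≠ r) :
    (cutLabelings p q r q r).card ≤ (twinLabelings G r q).card + (rootedLabelings p r).card := by
  classical
  rw [← Finset.card_sdiff_add_card_inter _ (rootedLabelings p r)]
  refine add_le_add (Finset.card_le_card ?_) (Finset.card_le_card Finset.inter_subset_right)
  intro L hL
  rw [Finset.mem_sdiff] at hL
  obtain ⟨hL, hL'⟩ := hL
  simp only [cutLabelings, rerootedLabelings, Finset.mem_filter, Finset.mem_univ, true_and] at hL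
  have hqr : ¬ IsAncestor p q r := fun h => hq (H.eq_root_of_isAncestor h)
  have hτr : cutTerminal p q r q r = r := by simp [cutTerminal, hqr]
  have hr : cutParent p q r = r := by rw [cutParent_of_ne p hq.symm, H.parent_root]
  have hmax : ∀ v, L v ≤ L r := by
    intro v
    have := hL r v (by simp [rerootedSet, hr])
    simpa [rerootedBase, hr, hτr] using this
  have hpar : ∀ v, v ≠ q → L v ≤ L (p v) := by
    intro v hv
    by_cases hpr : p v = r
    · rw [hpr]
      exact hmax v
    · have hle : cutLE p q (p v) v := ⟨isAncestor_parent p v, isAncestor_parent_iff hv⟩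
      by_cases hpq : p v = q
      · have hv' : IsAncestor p q v := hpq ▸ isAncestor_parent p v
        have := hL q v (by
          simp [rerootedSet, cutParent_self, hq, cutTerminal, IsAncestor.refl, hv'])
        simpa [rerootedBase, cutParent_self, cutTerminal, IsAncestor.refl, hpq] using this
      · have h1 : cutParent p q (p v) ≠ p v := by
          rw [cutParent_of_ne p hpq]
          exact H.parent_ne hpr
        have h2 : ¬ cutLE p q (p v) (cutTerminal p q r q (p v)) := by
          intro h
          unfold cutTerminal at h
          split_ifs at h with h3
          · exact hpq (H.antisymm h.1 h3)
          · exact hpr (H.eq_root_of_isAncestor h.1)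
        have := hL (p v) v (by simp [rerootedSet, h1, h2, hle])
        simpa [rerootedBase, h1, h2] using this
  have hlt : L (p q) < L q := by
    by_contra h
    refine hL' (H.mem_rootedLabelings fun v => ?_)
    by_cases hv : v = q
    · rw [hv]
      exact not_lt.1 h
    · exact hpar v hv
  have hne : ∀ u w, u ≠ w → L u ≤ L w → L u < L w :=
    fun u w h h' => lt_of_le_of_ne h' fun h'' => h (L.injective h'')
  rw [mem_twinLabelings]
  refine ⟨hne _ _ hq (hmax q), fun v => ⟨fun hv => ?_, ?_⟩⟩
  · by_contra hcon
    push Not at hcon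
    exact absurd (hpar v hcon.2) (not_le.2 (hv _ ((H.adj_iff _ _).2 (Or.inl ⟨hcon.1, rfl⟩))))
  · rintro (rfl | rfl)
    · intro w hw
      exact hne _ _ hw.ne' (hmax w)
    · intro w hw
      rcases (H.adj_iff _ _).1 hw with ⟨_, rfl⟩ | ⟨h1, rfl⟩
      · exact hlt
      · exact hne _ _ (H.parent_ne h1).symm (hpar w (H.parent_ne h1).symm)

end IsParentMap

end Cut

/-! ### Sizes of subtrees and generations. -/

section Sizes

/-- The number of vertices of a tree of depth `l` in which every inner vertex has `d` children. -/
def subtreeSize (d : ℕ) : ℕ → ℕ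
  | 0 => 1
  | l + 1 => 1 + d * subtreeSize d l

lemma pow_mul_subtreeSize_le (d j l : ℕ) : d ^ l * subtreeSize d j ≤ subtreeSize d (j + l) := by
  induction l with
  | zero => simp
  | succ l ih =>
    rw [← add_assoc, subtreeSize, pow_succ']
    nlinarith

variable {V : Type u} [Fintype V] {G : SimpleGraph V} {r : V} {p : V → V} {d k : ℕ}

open Classical in
/-- The children of `v`. -/
noncomputable def treeChildren (p : V → V) (r v : V) : Finset V :=
  Finset.univ.filter (fun w => w ≠ r ∧ p w = v)

lemma mem_descendants {v w : V} : w ∈ descendants p v ↔ IsAncestor p v w := by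
  simp [descendants]

lemma mem_treeChildren {v w : V} : w ∈ treeChildren p r v ↔ w ≠ r ∧ p w = v := by
  simp [treeChildren]

namespace IsParentMap

variable (H : IsParentMap G r p)
include H

lemma card_descendants_eq_sum (v : V) :
    (descendants p v).card = 1 + ∑ c ∈ treeChildren p r v, (descendants p c).card := by
  classical
  have hset : descendants p v = insert v ((treeChildren p r v).biUnion (descendants p)) := by
    ext w
    simp only [mem_descendants, Finset.mem_insert, Finset.mem_biUnion, mem_treeChildren]
    constructor
    · rintro ⟨i, hi⟩
      induction i with
      | zero => exact Or.inl hi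
      | succ i ih =>
        rw [Function.iterate_succ_apply'] at hi
        by_cases h : p^[i] w = r
        · refine ih ?_
          rw [h] at hi ⊢
          rw [← hi, H.parent_root]
        · exact Or.inr ⟨_, ⟨h, hi⟩, i, rfl⟩
    · rintro (rfl | ⟨c, ⟨_, rfl⟩, hc⟩)
      · exact IsAncestor.refl p w
      · exact (isAncestor_parent p c).trans hc
  rw [hset, Finset.card_insert_of_notMem, Finset.card_biUnion, add_comm]
  · intro c hc c' hc' hne
    rw [Function.onFun, Finset.disjoint_left]
    intro w hw hw'
    rw [mem_descendants] at hw hw'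
    rw [Finset.mem_coe, mem_treeChildren] at hc hc'
    have h1 := H.dist_parent c hc.1
    have h2 := H.dist_parent c' hc'.1
    rw [hc.2] at h1
    rw [hc'.2] at h2
    rcases hw.chain hw' with h | h
    · exact hne (H.eq_of_isAncestor_of_dist_eq h (by omega))
    · exact hne (H.eq_of_isAncestor_of_dist_eq h (by omega)).symm
  · simp only [Finset.mem_biUnion, mem_treeChildren, mem_descendants, not_exists, not_and]
    rintro c ⟨hc, rfl⟩ h
    exact H.parent_ne hc (H.antisymm (isAncestor_parent p c) h)

lemma card_treeChildren_root (hT : IsRegularTree G r d k) (hk : 0 < k) :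
    (treeChildren p r r).card = d + 1 := by
  rw [← hT.root_children hk, ← Set.ncard_coe_finset]
  congr 1
  ext w
  rw [Finset.mem_coe, mem_treeChildren, Set.mem_ofPred_eq, H.adj_iff]
  constructor
  · rintro ⟨h1, h2⟩
    refine ⟨Or.inr ⟨h1, h2⟩, ?_⟩
    have := H.dist_parent w h1
    rw [h2] at this
    simpa using this.symm
  · rintro ⟨h1 | h1, _⟩
    · exact absurd rfl h1.1
    · exact h1

lemma card_treeChildren (hT : IsRegularTree G r d k) {v : V} (hv : v ≠ r)
    (hvk : G.dist r v < k) : (treeChildren p r v).card = d := by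
  rw [← hT.children v (Nat.pos_of_ne_zero fun h => hv (H.eq_root_of_dist h)) hvk,
    ← Set.ncard_coe_finset]
  congr 1
  ext w
  rw [Finset.mem_coe, mem_treeChildren, Set.mem_ofPred_eq, H.adj_iff]
  constructor
  · rintro ⟨h1, h2⟩
    refine ⟨Or.inr ⟨h1, h2⟩, ?_⟩
    have := H.dist_parent w h1
    rw [h2] at this
    exact this.symm
  · rintro ⟨⟨h1, rfl⟩ | h1, h3⟩
    · have := H.dist_parent v h1
      omega
    · exact h1

lemma dist_of_mem_treeChildren {v c : V} (hc : c ∈ treeChildren p r v) :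
    G.dist r c = G.dist r v + 1 := by
  rw [mem_treeChildren] at hc
  have := H.dist_parent c hc.1
  rw [hc.2] at this
  exact this.symm

lemma card_descendants (hT : IsRegularTree G r d k) {v : V} (hv : v ≠ r) :
    (descendants p v).card = subtreeSize d (k - G.dist r v) := by
  induction hl : k - G.dist r v generalizing v with
  | zero =>
    rw [H.card_descendants_eq_sum, Finset.sum_eq_zero_iff_of_nonneg (by simp) |>.2]
    · rfl
    · intro c hc
      have h1 := H.dist_of_mem_treeChildren hc
      have h2 := hT.depth_le c
      omega
  | succ l ih =>
    rw [H.card_descendants_eq_sum, subtreeSize, Finset.sum_congr rfl (g := fun _ => subtreeSize d l)]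
    · rw [Finset.sum_const, H.card_treeChildren hT hv (by omega), smul_eq_mul]
    · intro c hc
      have h1 := H.dist_of_mem_treeChildren hc
      exact ih (mem_treeChildren.1 hc).1 (by omega)

lemma descendants_root : descendants p r = Finset.univ := by
  ext w
  simp [mem_descendants, H.isAncestor_root]

lemma card_eq (hT : IsRegularTree G r d k) (hk : 0 < k) :
    Fintype.card V = 1 + (d + 1) * subtreeSize d (k - 1) := by
  rw [← Finset.card_univ, ← H.descendants_root, H.card_descendants_eq_sum,
    Finset.sum_congr rfl (g := fun _ => subtreeSize d (k - 1))]
  · rw [Finset.sum_const, H.card_treeChildren_root hT hk, smul_eq_mul]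
  · intro c hc
    have h1 := H.dist_of_mem_treeChildren hc
    rw [SimpleGraph.dist_self] at h1
    rw [H.card_descendants hT (mem_treeChildren.1 hc).1, h1]

open Classical in
lemma card_generation (hT : IsRegularTree G r d k) {g : ℕ} (hg : g < k) :
    (Finset.univ.filter (fun v => G.dist r v = g + 1)).card = (d + 1) * d ^ g := by
  have hfib : ∀ g, (Finset.univ.filter (fun v => G.dist r v = g + 1)).card =
      ∑ u ∈ Finset.univ.filter (fun u => G.dist r u = g), (treeChildren p r u).card := by
    intro g
    rw [Finset.card_eq_sum_card_fiberwise (f := p)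
      (t := Finset.univ.filter (fun u => G.dist r u = g))]
    · refine Finset.sum_congr rfl fun u hu => ?_
      congr 1
      ext w
      simp only [Finset.mem_filter, Finset.mem_univ, true_and, mem_treeChildren] at hu ⊢
      constructor
      · rintro ⟨h1, h2⟩
        refine ⟨?_, h2⟩
        rintro rfl
        simp at h1
      · rintro ⟨h1, h2⟩
        have := H.dist_parent w h1
        rw [h2, hu] at this
        exact ⟨this.symm, h2⟩
    · intro v hv
      simp only [Finset.coe_filter, Finset.mem_univ, true_and, Set.mem_ofPred_eq] at hv ⊢
      have hvr : v ≠ r := by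
        rintro rfl
        simp at hv
      have := H.dist_parent v hvr
      omega
  induction g with
  | zero =>
    rw [hfib, pow_zero, mul_one]
    have : Finset.univ.filter (fun u => G.dist r u = 0) = {r} := by
      ext u
      simp only [Finset.mem_filter, Finset.mem_univ, true_and, Finset.mem_singleton]
      exact ⟨H.eq_root_of_dist, fun h => by simp [h]⟩
    rw [this, Finset.sum_singleton, H.card_treeChildren_root hT hg]
  | succ g ih =>
    rw [hfib, Finset.sum_congr rfl (g := fun _ => d)]
    · rw [Finset.sum_const, ih (by omega), smul_eq_mul, pow_succ, mul_assoc]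
    · intro u hu
      simp only [Finset.mem_filter, Finset.mem_univ, true_and] at hu
      refine H.card_treeChildren hT ?_ (by omega)
      rintro rfl
      simp at hu

lemma pow_mul_card_descendants_le (hT : IsRegularTree G r d k) {c q : V} (hc : c ≠ r)
    (h : IsAncestor p c q) :
    d ^ (G.dist r q - G.dist r c) * (descendants p q).card ≤ (descendants p c).card := by
  have hq : q ≠ r := by
    rintro rfl
    exact hc (H.eq_root_of_isAncestor h)
  have h1 := H.dist_le_of_isAncestor h
  have h2 := hT.depth_le q
  rw [H.card_descendants hT hq, H.card_descendants hT hc]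
  have := pow_mul_subtreeSize_le d (k - G.dist r q) (G.dist r q - G.dist r c)
  rwa [show k - G.dist r q + (G.dist r q - G.dist r c) = k - G.dist r c by omega] at this

lemma pow_mul_card_descendants_le_subtreeSize (hT : IsRegularTree G r d k) {c : V} (hc : c ≠ r) :
    d ^ (G.dist r c - 1) * (descendants p c).card ≤ subtreeSize d (k - 1) := by
  have h1 : 0 < G.dist r c := Nat.pos_of_ne_zero fun h => hc (H.eq_root_of_dist h)
  have h2 := hT.depth_le c
  rw [H.card_descendants hT hc]
  have := pow_mul_subtreeSize_le d (k - G.dist r c) (G.dist r c - 1)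
  rwa [show k - G.dist r c + (G.dist r c - 1) = k - 1 by omega] at this

lemma card_descendants_le_subtreeSize (hT : IsRegularTree G r d k) (hd : 0 < d) {c : V}
    (hc : c ≠ r) : (descendants p c).card ≤ subtreeSize d (k - 1) :=
  le_trans (Nat.le_mul_of_pos_left _ (pow_pos hd _))
    (H.pow_mul_card_descendants_le_subtreeSize hT hc)

omit H in
lemma card_descendants_pos (v : V) : 0 < (descendants p v).card :=
  Finset.card_pos.2 ⟨v, mem_descendants.2 (IsAncestor.refl p v)⟩

end IsParentMap

end Sizes

/-! ### Hook products compared with those of the root. -/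

section Estimates

/-- The cost of moving the top of a labeling from the root to a vertex of generation `g`. -/
noncomputable def movingCost (d g : ℕ) : ℝ :=
  ∏ j ∈ Finset.range g, 1 / (((d : ℝ) - 1) * (d : ℝ) ^ j)

lemma div_le_one_div_of_mul_le {n s t : ℝ} (hn : 0 < n) (ht : 0 < t) (h : t * n ≤ s) :
    n / s ≤ 1 / t := by
  have hs : 0 < s := lt_of_lt_of_le (mul_pos ht hn) h
  rw [div_le_div_iff₀ hs ht]
  linarith

lemma sum_range_pow_succ_le {x : ℝ} (h0 : 0 ≤ x) (h1 : x < 1) (m : ℕ) :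
    ∑ j ∈ Finset.range m, x ^ (j + 1) ≤ x / (1 - x) := by
  have h : ∑ j ∈ Finset.range m, x ^ (j + 1) = x * ∑ j ∈ Finset.range m, x ^ j := by
    rw [Finset.mul_sum]
    exact Finset.sum_congr rfl fun j _ => by ring
  rw [h, div_eq_mul_inv]
  refine mul_le_mul_of_nonneg_left ?_ h0
  rw [← tsum_geometric_of_lt_one h0 h1]
  exact (summable_geometric_of_lt_one h0 h1).sum_le_tsum _ fun _ _ => pow_nonneg h0 _

lemma one_sub_sum_le_prod_one_sub_pow {x : ℝ} (h0 : 0 ≤ x) (h1 : x ≤ 1) (m : ℕ) :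
    1 - ∑ j ∈ Finset.range m, x ^ (j + 1) ≤ ∏ j ∈ Finset.range m, (1 - x ^ (j + 1)) ∧
      ∏ j ∈ Finset.range m, (1 - x ^ (j + 1)) ≤ 1 := by
  induction m with
  | zero => simp
  | succ m ih =>
    rw [Finset.sum_range_succ, Finset.prod_range_succ]
    have h2 : 0 ≤ x ^ (m + 1) := pow_nonneg h0 _
    have h3 : x ^ (m + 1) ≤ 1 := pow_le_one₀ h0 h1
    have h4 : 0 ≤ ∏ j ∈ Finset.range m, (1 - x ^ (j + 1)) :=
      Finset.prod_nonneg fun j _ => sub_nonneg.2 (pow_le_one₀ h0 h1)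
    constructor
    · nlinarith [ih.1, ih.2]
    · nlinarith [ih.1, ih.2]

/-- By the Weierstrass inequality, `∏ (1 - D⁻ⁱ) ≥ 1 - ∑ D⁻ⁱ ≥ 1 - 1/(D-1)`. The index `j + 1 = g`
stands for the cut vertex itself and contributes 1. -/
lemma prod_one_div_one_sub_pow_le {D : ℝ} (hD : 2 < D) (g : ℕ) :
    ∏ j ∈ Finset.range g,
      (if j + 1 < g then 1 / (1 - (1 / D) ^ (g - (j + 1))) else 1) ≤ (D - 1) / (D - 2) := by
  have hx0 : 0 ≤ 1 / D := by positivity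
  have hx1 : 1 / D < 1 := by rw [div_lt_one (by linarith)]; linarith
  have hone : 1 ≤ (D - 1) / (D - 2) := by rw [le_div_iff₀ (by linarith)]; linarith
  cases g with
  | zero => simpa using hone
  | succ m =>
    rw [← Finset.prod_range_reflect, Finset.prod_range_succ']
    have hterm : ∀ j ∈ Finset.range m,
        (if m + 1 - 1 - (j + 1) + 1 < m + 1 then
          1 / (1 - (1 / D) ^ (m + 1 - (m + 1 - 1 - (j + 1) + 1))) else 1) =
        (1 - (1 / D) ^ (j + 1))⁻¹ := by
      intro j hj
      rw [Finset.mem_range] at hj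
      rw [if_pos (by omega), one_div, show m + 1 - (m + 1 - 1 - (j + 1) + 1) = j + 1 by omega]
    rw [Finset.prod_congr rfl hterm, if_neg (by omega), mul_one, Finset.prod_inv_distrib]
    have h1 := (one_sub_sum_le_prod_one_sub_pow hx0 hx1.le m).1
    have h2 := sum_range_pow_succ_le hx0 hx1 m
    have h3 : 1 / D / (1 - 1 / D) = 1 / (D - 1) := by
      field_simp
    have h4 : (D - 2) / (D - 1) ≤ ∏ j ∈ Finset.range m, (1 - (1 / D) ^ (j + 1)) := by
      have : (D - 2) / (D - 1) = 1 - 1 / (D - 1) := by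
        have : D - 1 ≠ 0 := by linarith
        field_simp
        ring
      linarith
    have h5 : 0 < (D - 2) / (D - 1) := div_pos (by linarith) (by linarith)
    calc _ ≤ ((D - 2) / (D - 1))⁻¹ := inv_anti₀ h5 h4
      _ = _ := inv_div _ _

lemma prod_ite_lt_const (z : ℝ) (m n : ℕ) :
    ∏ j ∈ Finset.range n, (if m < j + 1 then z else 1) = z ^ (n - m) := by
  induction n with
  | zero => simp
  | succ n ih =>
    rw [Finset.prod_range_succ, ih]
    split_ifs with h
    · rw [← pow_succ]
      congr 1
      omega
    · rw [mul_one, show n - m = 0 by omega, show n + 1 - m = 0 by omega]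

variable {V : Type u} [Fintype V] {G : SimpleGraph V} {r : V} {p : V → V} {d k : ℕ}

open Classical in
lemma card_rerootedSet_cut_self {q a b : V} (hab : a ≠ b) (top : V) :
    (rerootedSet (cutParent p q) (cutLE p q) (cutTerminal p q a b) top q).card =
      if q = top then Fintype.card V else (descendants p q).card := by
  classical
  unfold rerootedSet
  rw [if_pos (cutParent_self p q)]
  split_ifs with h
  · exact Finset.card_univ
  · congr 1
    ext w
    simp only [cutTerminal, IsAncestor.refl, if_true, Finset.mem_filter, Finset.mem_univ, true_and,
      mem_descendants]
    by_cases hw : IsAncestor p q w <;> simp [hw, hab]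

namespace IsParentMap

variable (H : IsParentMap G r p)
include H

open Classical in
lemma card_rerootedSet_cut_root {q a b : V} (hq : q ≠ r) (hab : a ≠ b) (top : V) :
    (rerootedSet (cutParent p q) (cutLE p q) (cutTerminal p q a b) top r).card =
      if r = top then Fintype.card V else Fintype.card V - (descendants p q).card := by
  classical
  have hqr : ¬ IsAncestor p q r := fun h => hq (H.eq_root_of_isAncestor h)
  unfold rerootedSet
  rw [if_pos (by rw [cutParent_of_ne p hq.symm, H.parent_root])]
  split_ifs with h
  · exact Finset.card_univ
  · rw [← Finset.card_compl]
    congr 1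
    ext w
    simp only [cutTerminal, hqr, if_false, Finset.mem_filter, Finset.mem_univ, true_and,
      mem_descendants, Finset.mem_compl]
    by_cases hw : IsAncestor p q w <;> simp [hw, hab.symm]

-- Only the hooks on the paths from `q` to `b` and from the root to `a` are inverted; elsewhere the
-- hook is the old subtree, without the part that was cut off.
open Classical in
lemma rerootedSet_cut {q a b c : V} (hab : a ≠ b) (hcr : c ≠ r) (hcq : c ≠ q) (top : V) :
    (IsAncestor p q c → IsAncestor p c b →
      rerootedSet (cutParent p q) (cutLE p q) (cutTerminal p q a b) top c =
        (descendants p q) \ (descendants p c)) ∧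
    (IsAncestor p q c → IsAncestor p q b → ¬ IsAncestor p c b →
      rerootedSet (cutParent p q) (cutLE p q) (cutTerminal p q a b) top c = descendants p c) ∧
    (¬ IsAncestor p q c → ¬ IsAncestor p q a → IsAncestor p c a →
      rerootedSet (cutParent p q) (cutLE p q) (cutTerminal p q a b) top c =
        (descendants p q ∪ descendants p c)ᶜ) ∧
    (¬ IsAncestor p q c → ¬ IsAncestor p c a →
      rerootedSet (cutParent p q) (cutLE p q) (cutTerminal p q a b) top c =
        descendants p c \ descendants p q) := by
  classical
  have hroot : cutParent p q c ≠ c := by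
    rw [cutParent_of_ne p hcq]
    exact H.parent_ne hcr
  unfold rerootedSet
  rw [if_neg hroot]
  refine ⟨fun h1 h2 => ?_, fun h1 h2 h3 => ?_, fun h1 h2 h3 => ?_, fun h1 h2 => ?_⟩
  · rw [if_pos (by simp [cutTerminal, cutLE, h1, h2, h1.trans h2])]
    ext w
    simp only [Finset.mem_filter, Finset.mem_univ, true_and, Finset.mem_sdiff, mem_descendants]
    by_cases hw : IsAncestor p q w <;> simp [hw, cutTerminal, cutLE, h1, hab]
  · rw [if_neg (by simp [cutTerminal, cutLE, h1, h3])]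
    ext w
    simp only [Finset.mem_filter, Finset.mem_univ, true_and, mem_descendants]
    exact ⟨fun h => h.1, fun h => ⟨h, by simp [h1, h1.trans h]⟩⟩
  · rw [if_pos (by simp [cutTerminal, cutLE, h1, h2, h3])]
    ext w
    simp only [Finset.mem_filter, Finset.mem_univ, true_and, Finset.mem_compl, Finset.mem_union,
      mem_descendants, not_or]
    by_cases hw : IsAncestor p q w <;> simp [hw, cutTerminal, cutLE, h1, hab.symm]
  · rw [if_neg (by simp [cutTerminal, cutLE, h1, h2])]
    ext w
    simp only [Finset.mem_filter, Finset.mem_univ, true_and, Finset.mem_sdiff, mem_descendants]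
    simp [cutLE, h1]

/-- Both counts times their hook products equal `N!`, so their ratio is a product of ratios of hook
sizes. -/
lemma card_cutLabelings_eq {q a b : V} (hq : q ≠ r) (ha : ¬ IsAncestor p q a)
    (hb : IsAncestor p q b) (top : V) :
    ((cutLabelings p q a b top).card : ℝ) = (rootedLabelings p r).card *
      ∏ c, ((descendants p c).card : ℝ) /
        (rerootedSet (cutParent p q) (cutLE p q) (cutTerminal p q a b) top c).card := by
  have h1 := H.card_cutLabelings_mul hq ha hb top
  have h2 := H.card_rootedLabelings_mul
  have h3 : ∏ c, (rerootedSet (cutParent p q) (cutLE p q) (cutTerminal p q a b) top c).card ≠ 0 := by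
    intro h
    rw [h, mul_zero] at h1
    exact (Nat.factorial_pos _).ne h1
  rw [Finset.prod_div_distrib, ← mul_div_assoc, eq_div_iff (by exact_mod_cast h3)]
  exact_mod_cast h1.trans h2.symm

lemma card_rootedLabelings_pos : 0 < (rootedLabelings p r).card := by
  have h2 := H.card_rootedLabelings_mul
  by_contra h
  rw [Nat.eq_zero_of_not_pos h, zero_mul] at h2
  exact (Nat.factorial_pos _).ne h2

lemma pow_mul_add_le (hT : IsRegularTree G r d k) (hk : 0 < k) (hd : 2 ≤ d) {c : V} (hc : c ≠ r) :
    (d : ℝ) ^ (G.dist r c) * (descendants p c).card + (descendants p c).card ≤ Fintype.card V := by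
  have h1 := H.pow_mul_card_descendants_le_subtreeSize hT hc
  have h2 := H.card_descendants_le_subtreeSize hT (by omega) hc
  have h4 : G.dist r c ≠ 0 := fun h => hc (H.eq_root_of_dist h)
  rw [H.card_eq hT hk]
  obtain ⟨g, hg⟩ := Nat.exists_eq_succ_of_ne_zero h4
  rw [hg] at h1 ⊢
  have : d ^ (g + 1) * (descendants p c).card + (descendants p c).card ≤
      1 + (d + 1) * subtreeSize d (k - 1) := by
    rw [pow_succ]
    simp only [Nat.succ_eq_add_one, Nat.add_sub_cancel] at h1
    nlinarith
  exact_mod_cast this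

/-- Let `s` be the size of a branch at the root. The three summands are at most `(d-1) * s`, `s` and
`s`, and `N = 1 + (d+1) * s`. -/
lemma pow_mul_add_add_le (hT : IsRegularTree G r d k) (hk : 0 < k) (hd : 2 ≤ d) {c q : V}
    (hc : c ≠ r) (hq : q ≠ r) :
    ((d : ℝ) - 1) * (d : ℝ) ^ (G.dist r c - 1) * (descendants p c).card + (descendants p c).card +
      (descendants p q).card ≤ Fintype.card V := by
  have h1 := H.pow_mul_card_descendants_le_subtreeSize hT hc
  have h2 := H.card_descendants_le_subtreeSize hT (by omega) hc
  have h3 := H.card_descendants_le_subtreeSize hT (by omega) hq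
  rw [H.card_eq hT hk]
  have h1' : (d : ℝ) ^ (G.dist r c - 1) * (descendants p c).card ≤ subtreeSize d (k - 1) := by
    exact_mod_cast h1
  have h2' : ((descendants p c).card : ℝ) ≤ subtreeSize d (k - 1) := by exact_mod_cast h2
  have h3' : ((descendants p q).card : ℝ) ≤ subtreeSize d (k - 1) := by exact_mod_cast h3
  have hd' : (2 : ℝ) ≤ d := by exact_mod_cast hd
  push_cast
  nlinarith

-- The three factors belong to the ancestors of `q`, whose hook loses the subtree of `q`; to the
-- ancestors of `a`, whose hook becomes the complement of their subtree outside that of `q`; and to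
-- the vertices strictly below `q` towards `b`, whose hook becomes a complement inside the subtree
-- of `q`.
open Classical in
lemma factor_le (hT : IsRegularTree G r d k) (hk : 0 < k) (hd : 3 ≤ d) {q a b c : V} (hq : q ≠ r)
    (ha : ¬ IsAncestor p q a) (hb : IsAncestor p q b) (hcr : c ≠ r) (hcq : c ≠ q) (top : V) :
    ((descendants p c).card : ℝ) /
        (rerootedSet (cutParent p q) (cutLE p q) (cutTerminal p q a b) top c).card ≤
      (if IsAncestor p c q ∧ c ≠ r then
        (if G.dist r c < G.dist r q then 1 / (1 - (1 / (d : ℝ)) ^ (G.dist r q - G.dist r c)) else 1)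
        else 1) *
      (if IsAncestor p c a ∧ c ≠ r then 1 / (((d : ℝ) - 1) * (d : ℝ) ^ (G.dist r c - 1)) else 1) *
      (if IsAncestor p c b ∧ c ≠ r then (if G.dist r q < G.dist r c then 1 / ((d : ℝ) - 1) else 1)
        else 1) := by
  have hab : a ≠ b := by
    rintro rfl
    exact ha hb
  obtain ⟨hS1, hS2, hS3, hS4⟩ := H.rerootedSet_cut (q := q) hab hcr hcq top
  have hD : (3 : ℝ) ≤ d := by exact_mod_cast hd
  have hn : (0 : ℝ) < (descendants p c).card := by
    exact_mod_cast card_descendants_pos c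
  have hsub : ∀ u w, IsAncestor p u w → descendants p w ⊆ descendants p u := by
    intro u w h x hx
    rw [mem_descendants] at hx ⊢
    exact h.trans hx
  have hsdiff : ∀ u w, IsAncestor p u w → ((descendants p u \ descendants p w).card : ℝ) =
      (descendants p u).card - (descendants p w).card := by
    intro u w h
    rw [Finset.card_sdiff_of_subset (hsub u w h), Nat.cast_sub (Finset.card_le_card (hsub u w h))]
  by_cases h1 : IsAncestor p q c
  · have h2 : ¬ IsAncestor p c q := fun h => hcq (H.antisymm h h1)
    have h3 : ¬ IsAncestor p c a := fun h => ha (h1.trans h)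
    have hlt := H.dist_lt_of_isAncestor h1 hcq.symm
    by_cases h4 : IsAncestor p c b
    · rw [hS1 h1 h4]
      simp only [h2, h3, h4, hcr, hlt, ne_eq, not_false_eq_true, and_self, false_and, if_true,
        if_false, one_mul]
      refine div_le_one_div_of_mul_le hn (by linarith) ?_
      have h5 := H.pow_mul_card_descendants_le hT hq h1
      have h5' : (d : ℝ) ^ (G.dist r c - G.dist r q) * (descendants p c).card ≤
        (descendants p q).card := by exact_mod_cast h5
      have h6 : (d : ℝ) ≤ (d : ℝ) ^ (G.dist r c - G.dist r q) :=
        le_self_pow₀ (by linarith) (by omega)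
      rw [hsdiff q c h1]
      nlinarith
    · rw [hS2 h1 hb h4]
      simp only [h2, h3, h4, false_and, if_false, one_mul]
      rw [div_self hn.ne']
  · have h2 : ¬ (IsAncestor p c b ∧ G.dist r q < G.dist r c) := by
      rintro ⟨h3, h4⟩
      rcases h3.chain hb with h5 | h5
      · exact absurd (H.dist_le_of_isAncestor h5) (not_le.2 h4)
      · exact h1 h5
    have h2' : (if IsAncestor p c b ∧ c ≠ r then
        (if G.dist r q < G.dist r c then 1 / ((d : ℝ) - 1) else 1) else 1) = 1 := by
      split_ifs <;> tauto
    rw [h2', mul_one]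
    by_cases h3 : IsAncestor p c q
    · have hlt := H.dist_lt_of_isAncestor h3 hcq
      have hpow : (d : ℝ) ^ (G.dist r q - G.dist r c) * (descendants p q).card ≤
          (descendants p c).card := by
        exact_mod_cast H.pow_mul_card_descendants_le hT hcr h3
      have hpos : (0 : ℝ) < (d : ℝ) ^ (G.dist r q - G.dist r c) := by positivity
      have hx : (1 / (d : ℝ)) ^ (G.dist r q - G.dist r c) < 1 := by
        refine pow_lt_one₀ (by positivity) ?_ (by omega)
        rw [div_lt_one (by linarith)]
        linarith
      have hx0 : 0 ≤ (1 / (d : ℝ)) ^ (G.dist r q - G.dist r c) := by positivity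
      by_cases h4 : IsAncestor p c a
      · rw [hS3 h1 ha h4]
        simp only [h3, h4, hcr, hlt, ne_eq, not_false_eq_true, and_self, if_true]
        have h5 : ((descendants p c).card : ℝ) / ((descendants p q ∪ descendants p c)ᶜ).card ≤
            1 / (((d : ℝ) - 1) * (d : ℝ) ^ (G.dist r c - 1)) := by
          refine div_le_one_div_of_mul_le hn (mul_pos (by linarith) (by positivity)) ?_
          rw [Finset.union_eq_right.2 (hsub c q h3), Finset.card_compl,
            Nat.cast_sub (Finset.card_le_univ _)]
          have := H.pow_mul_add_add_le hT hk (by omega) hcr hq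
          have h6 : (0 : ℝ) ≤ (descendants p q).card := Nat.cast_nonneg _
          linarith
        -- For a common ancestor of `q` and `a` the second factor alone is an upper bound, and the
        -- first one is at least 1.
        refine h5.trans (le_mul_of_one_le_left ?_ ?_)
        · have : (0 : ℝ) < (d : ℝ) - 1 := by linarith
          positivity
        · rw [le_div_iff₀ (by linarith)]
          linarith
      · rw [hS4 h1 h4]
        simp only [h3, h4, hcr, hlt, ne_eq, not_false_eq_true, and_self, false_and, if_true,
          if_false, mul_one]
        refine div_le_one_div_of_mul_le hn (by linarith) ?_
        rw [hsdiff c q h3, sub_mul, one_mul, one_div, inv_pow]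
        refine sub_le_sub_left ?_ _
        rw [inv_mul_eq_div, le_div_iff₀ hpos]
        linarith
    · simp only [h3, false_and, if_false, one_mul]
      by_cases h4 : IsAncestor p c a
      · rw [hS3 h1 ha h4]
        simp only [h4, hcr, ne_eq, not_false_eq_true, and_self, if_true]
        refine div_le_one_div_of_mul_le hn (mul_pos (by linarith) (by positivity)) ?_
        rw [Finset.card_compl, Nat.cast_sub (Finset.card_le_univ _)]
        have := H.pow_mul_add_add_le hT hk (by omega) hcr hq
        have h6 : ((descendants p q ∪ descendants p c).card : ℝ) ≤
            (descendants p q).card + (descendants p c).card := by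
          exact_mod_cast Finset.card_union_le (descendants p q) (descendants p c)
        linarith
      · rw [hS4 h1 h4]
        simp only [h4, false_and, if_false]
        rw [Finset.sdiff_eq_self_of_disjoint, div_self hn.ne']
        rw [Finset.disjoint_left]
        intro w hw hw'
        rw [mem_descendants] at hw hw'
        rcases hw.chain hw' with h | h
        · exact h3 h
        · exact h1 h

/-- The bound for the number of labelings decreasing away from `a` and `b` in the components. -/
theorem card_cutLabelings_le_mul (hT : IsRegularTree G r d k) (hk : 0 < k) (hd : 3 ≤ d)
    {q a b : V} (hq : q ≠ r) (ha : ¬ IsAncestor p q a) (hb : IsAncestor p q b) {top : V} {C : ℝ}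
    (hC : ((descendants p r).card : ℝ) /
        (rerootedSet (cutParent p q) (cutLE p q) (cutTerminal p q a b) top r).card *
      (((descendants p q).card : ℝ) /
        (rerootedSet (cutParent p q) (cutLE p q) (cutTerminal p q a b) top q).card) ≤ C) :
    ((cutLabelings p q a b top).card : ℝ) ≤ (rootedLabelings p r).card *
      (C * (((d : ℝ) - 1) / (d - 2) * movingCost d (G.dist r a) *
        (1 / ((d : ℝ) - 1)) ^ (G.dist r b - G.dist r q))) := by
  classical
  have hD : (3 : ℝ) ≤ d := by exact_mod_cast hd
  rw [H.card_cutLabelings_eq hq ha hb top]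
  refine mul_le_mul_of_nonneg_left ?_ (Nat.cast_nonneg _)
  have hC0 : 0 ≤ C := le_trans (by positivity) hC
  -- The hooks at `r` and `q` depend on `top` and are accounted for by `C`; accordingly `F` equals 1
  -- there.
  let F : V → ℝ := fun c => (if IsAncestor p c q ∧ c ≠ r then
        (if G.dist r c < G.dist r q then 1 / (1 - (1 / (d : ℝ)) ^ (G.dist r q - G.dist r c)) else 1)
        else 1) *
      (if IsAncestor p c a ∧ c ≠ r then 1 / (((d : ℝ) - 1) * (d : ℝ) ^ (G.dist r c - 1)) else 1) *
      (if IsAncestor p c b ∧ c ≠ r then (if G.dist r q < G.dist r c then 1 / ((d : ℝ) - 1) else 1)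
        else 1)
  have hFr : F r = 1 := by simp [F]
  have hFq : F q = 1 := by simp [F, ha]
  have hF : ∏ c, F c ≤ ((d : ℝ) - 1) / (d - 2) * movingCost d (G.dist r a) *
        (1 / ((d : ℝ) - 1)) ^ (G.dist r b - G.dist r q) := by
    have hd1 : (0 : ℝ) < (d : ℝ) - 1 := by linarith
    simp only [F]
    rw [Finset.prod_mul_distrib, Finset.prod_mul_distrib,
      H.prod_ancestors q (fun j => if j < G.dist r q then
        1 / (1 - (1 / (d : ℝ)) ^ (G.dist r q - j)) else 1),
      H.prod_ancestors a (fun j => 1 / (((d : ℝ) - 1) * (d : ℝ) ^ (j - 1))),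
      H.prod_ancestors b (fun j => if G.dist r q < j then 1 / ((d : ℝ) - 1) else 1),
      prod_ite_lt_const]
    refine mul_le_mul_of_nonneg_right ?_ (by positivity)
    refine mul_le_mul (prod_one_div_one_sub_pow_le (by linarith) _) (le_of_eq ?_) ?_ ?_
    · simp [movingCost]
    · exact Finset.prod_nonneg fun j _ => by positivity
    · exact div_nonneg (by linarith) (by linarith)
  refine le_trans ?_ (mul_le_mul_of_nonneg_left hF hC0)
  clear hF
  let φ : V → ℝ := fun c => ((descendants p c).card : ℝ) /
    (rerootedSet (cutParent p q) (cutLE p q) (cutTerminal p q a b) top c).card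
  have hφ : ∀ c, 0 ≤ φ c := fun c => div_nonneg (Nat.cast_nonneg _) (Nat.cast_nonneg _)
  have hφF : ∀ c, c ≠ r → c ≠ q → φ c ≤ F c :=
    fun c hcr hcq => H.factor_le hT hk hd hq ha hb hcr hcq top
  have hqm : q ∈ Finset.univ.erase r := Finset.mem_erase.2 ⟨hq, Finset.mem_univ q⟩
  change ∏ c, φ c ≤ C * ∏ c, F c
  change φ r * φ q ≤ C at hC
  clear_value φ F
  rw [← Finset.mul_prod_erase _ φ (Finset.mem_univ r), ← Finset.mul_prod_erase _ φ hqm, ← mul_assoc,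
    ← Finset.mul_prod_erase _ F (Finset.mem_univ r), ← Finset.mul_prod_erase _ F hqm, hFr, hFq,
    one_mul, one_mul]
  refine mul_le_mul hC (Finset.prod_le_prod (fun c _ => hφ c) fun c hc => ?_)
    (Finset.prod_nonneg fun c _ => hφ c) hC0
  rw [Finset.mem_erase, Finset.mem_erase] at hc
  exact hφF c hc.2.1 hc.1

theorem card_cutLabelings_top_root_le (hT : IsRegularTree G r d k) (hk : 0 < k) (hd : 3 ≤ d)
    {q a b : V} (hq : q ≠ r) (ha : ¬ IsAncestor p q a) (hb : IsAncestor p q b) :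
    ((cutLabelings p q a b r).card : ℝ) ≤ (rootedLabelings p r).card *
      (((d : ℝ) - 1) / (d - 2) * movingCost d (G.dist r a) *
        (1 / ((d : ℝ) - 1)) ^ (G.dist r b - G.dist r q)) := by
  have hab : a ≠ b := by
    rintro rfl
    exact ha hb
  have := H.card_cutLabelings_le_mul hT hk hd hq ha hb (top := r) (C := 1) ?_
  · rwa [one_mul] at this
  · rw [H.card_rerootedSet_cut_root hq hab, card_rerootedSet_cut_self hab, if_pos rfl, if_neg hq,
      H.descendants_root, Finset.card_univ]
    exact mul_le_one₀ (div_self_le_one _) (by positivity) (div_self_le_one _)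

/-- With the overall maximum below the cut, the ratios at `r` and `q` multiply to `n / (N - n)`,
where `n` is the size of the subtree of `q`. This is the source of the additional power of `d`. -/
theorem card_cutLabelings_top_cut_le (hT : IsRegularTree G r d k) (hk : 0 < k) (hd : 3 ≤ d)
    {q a b : V} (hq : q ≠ r) (ha : ¬ IsAncestor p q a) (hb : IsAncestor p q b) :
    ((cutLabelings p q a b q).card : ℝ) ≤ (rootedLabelings p r).card *
      (1 / (d : ℝ) ^ G.dist r q * (((d : ℝ) - 1) / (d - 2) * movingCost d (G.dist r a) *
        (1 / ((d : ℝ) - 1)) ^ (G.dist r b - G.dist r q))) := by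
  have hab : a ≠ b := by
    rintro rfl
    exact ha hb
  refine H.card_cutLabelings_le_mul hT hk hd hq ha hb (top := q) ?_
  rw [H.card_rerootedSet_cut_root hq hab, card_rerootedSet_cut_self hab, if_pos rfl,
    if_neg hq.symm, H.descendants_root, Finset.card_univ, Nat.cast_sub (Finset.card_le_univ _)]
  have hn : (0 : ℝ) < (descendants p q).card := by exact_mod_cast card_descendants_pos q
  have hN : (0 : ℝ) < Fintype.card V := lt_of_lt_of_le hn (by exact_mod_cast Finset.card_le_univ _)
  have h1 := H.pow_mul_add_le hT hk (by omega) hq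
  have hd0 : (0 : ℝ) < (d : ℝ) ^ G.dist r q := by
    have : (0 : ℝ) < d := by exact_mod_cast (by omega : 0 < d)
    positivity
  rw [div_mul_div_comm, mul_comm, mul_div_mul_right _ _ hN.ne']
  exact div_le_one_div_of_mul_le hn hd0 (by linarith)

/-- With maxima at `r` and `q` no hook grows, and the one at `p q` shrinks from `1 + d * n` to `1 +
(d-1) * n`, a gain of at least `1 + 1/d`. Depth at least 2 is needed so that `p q` is not the root,
whose hook stays the whole tree. The labelings decreasing away from the root are then subtracted. -/
theorem card_twinLabelings_root_ge (hT : IsRegularTree G r d k) (hd : 3 ≤ d)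
    {q : V} (hq : 2 ≤ G.dist r q) :
    ((rootedLabelings p r).card : ℝ) / d ≤ (twinLabelings G r q).card := by
  classical
  have hD : (3 : ℝ) ≤ d := by exact_mod_cast hd
  have hqr : q ≠ r := by
    rintro rfl
    simp at hq
  have ha : ¬ IsAncestor p q r := fun h => hqr (H.eq_root_of_isAncestor h)
  have hpq := H.dist_parent q hqr
  have hpr : p q ≠ r := by
    intro h
    rw [h, SimpleGraph.dist_self] at hpq
    omega
  have h1 := H.card_cutLabelings_le q hqr
  have h1' : ((cutLabelings p q r q r).card : ℝ) ≤
      (twinLabelings G r q).card + (rootedLabelings p r).card := by exact_mod_cast h1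
  rw [H.card_cutLabelings_eq hqr ha (IsAncestor.refl p q) r] at h1'
  have hS : (0 : ℝ) < (rootedLabelings p r).card := by exact_mod_cast H.card_rootedLabelings_pos
  suffices hprod : 1 + 1 / (d : ℝ) ≤ ∏ c, ((descendants p c).card : ℝ) /
      (rerootedSet (cutParent p q) (cutLE p q) (cutTerminal p q r q) r c).card by
    have := mul_le_mul_of_nonneg_left hprod hS.le
    have h2 : ((rootedLabelings p r).card : ℝ) * (1 + 1 / d) =
        (rootedLabelings p r).card + (rootedLabelings p r).card / d := by ring
    linarith
  have hsd : ∀ c, c ≠ r → c ≠ q → ((rerootedSet (cutParent p q) (cutLE p q)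
      (cutTerminal p q r q) r c).card : ℝ) ≤ (descendants p c).card ∧
      (¬ IsAncestor p q c → rerootedSet (cutParent p q) (cutLE p q) (cutTerminal p q r q) r c =
        descendants p c \ descendants p q) := by
    intro c hcr hcq
    obtain ⟨_, hS2, _, hS4⟩ := H.rerootedSet_cut (q := q) (Ne.symm hqr) hcr hcq r
    have hcr' : ¬ IsAncestor p c r := fun h => hcr (H.eq_root_of_isAncestor h)
    refine ⟨?_, fun h => hS4 h hcr'⟩
    by_cases h : IsAncestor p q c
    · rw [hS2 h (IsAncestor.refl p q) fun h' => hcq (H.antisymm h' h)]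
    · rw [hS4 h hcr']
      exact Nat.cast_le.2 (Finset.card_le_card Finset.sdiff_subset)
  have hpos : ∀ c, (0 : ℝ) < (rerootedSet (cutParent p q) (cutLE p q)
      (cutTerminal p q r q) r c).card := by
    intro c
    have h3 := H.card_cutLabelings_mul hqr ha (IsAncestor.refl p q) r
    have h4 : (rerootedSet (cutParent p q) (cutLE p q) (cutTerminal p q r q) r c).card ≠ 0 := by
      intro h
      rw [Finset.prod_eq_zero (Finset.mem_univ c) h, mul_zero] at h3
      exact (Nat.factorial_pos _).ne h3
    exact_mod_cast Nat.pos_of_ne_zero h4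
  have hge : ∀ c, 1 ≤ ((descendants p c).card : ℝ) /
      (rerootedSet (cutParent p q) (cutLE p q) (cutTerminal p q r q) r c).card := by
    intro c
    rw [le_div_iff₀ (hpos c), one_mul]
    by_cases hcr : c = r
    · rw [hcr, H.card_rerootedSet_cut_root hqr hqr.symm, if_pos rfl, H.descendants_root,
        Finset.card_univ]
    · by_cases hcq : c = q
      · rw [hcq, card_rerootedSet_cut_self hqr.symm, if_neg hqr]
      · exact (hsd c hcr hcq).1
  rw [← Finset.mul_prod_erase _ _ (Finset.mem_univ (p q))]
  have hpq' : p q ≠ q := H.parent_ne hqr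
  have hnot : ¬ IsAncestor p q (p q) := fun h => hpq' (H.antisymm (isAncestor_parent p q) h)
  have hone : 1 ≤ ∏ c ∈ Finset.univ.erase (p q), ((descendants p c).card : ℝ) /
      (rerootedSet (cutParent p q) (cutLE p q) (cutTerminal p q r q) r c).card :=
    Finset.one_le_prod fun c _ => hge c
  have hmain : 1 + 1 / (d : ℝ) ≤ ((descendants p (p q)).card : ℝ) /
      (rerootedSet (cutParent p q) (cutLE p q) (cutTerminal p q r q) r (p q)).card := by
    rw [le_div_iff₀ (hpos _), (hsd _ hpr hpq').2 hnot]
    have hsub : descendants p q ⊆ descendants p (p q) := by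
      intro x hx
      rw [mem_descendants] at hx ⊢
      exact (isAncestor_parent p q).trans hx
    rw [Finset.card_sdiff_of_subset hsub, Nat.cast_sub (Finset.card_le_card hsub)]
    have hq' := hT.depth_le q
    have hrec : (descendants p (p q)).card = 1 + d * (descendants p q).card := by
      rw [H.card_descendants hT hpr, H.card_descendants hT hqr,
        show k - G.dist r (p q) = k - G.dist r q + 1 by omega, subtreeSize]
    have hn : (1 : ℝ) ≤ (descendants p q).card := by exact_mod_cast card_descendants_pos q
    rw [hrec]
    push_cast
    have hd0 : (0 : ℝ) < d := by linarith
    have : (1 + 1 / (d : ℝ)) * (1 + d * (descendants p q).card - (descendants p q).card) =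
        1 + d * (descendants p q).card + (1 - (descendants p q).card) / d := by
      field_simp
      ring
    rw [this]
    have : (1 - ((descendants p q).card : ℝ)) / d ≤ 0 :=
      div_nonpos_of_nonpos_of_nonneg (by linarith) hd0.le
    linarith
  exact hmain.trans (le_mul_of_one_le_right (zero_le_one.trans (hge _)) hone)

end IsParentMap

end Estimates

/-! ### Decay of the moving cost. -/

section MovingCost

lemma movingCost_zero (d : ℕ) : movingCost d 0 = 1 := by simp [movingCost]

lemma movingCost_succ (d g : ℕ) :
    movingCost d (g + 1) = movingCost d g * (1 / (((d : ℝ) - 1) * (d : ℝ) ^ g)) := by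
  rw [movingCost, Finset.prod_range_succ, movingCost]

variable {d : ℕ}

lemma movingCost_nonneg (hd : 3 ≤ d) (g : ℕ) : 0 ≤ movingCost d g := by
  have hD : (3 : ℝ) ≤ d := by exact_mod_cast hd
  have : (0 : ℝ) < (d : ℝ) - 1 := by linarith
  exact Finset.prod_nonneg fun j _ => by positivity

lemma movingCost_step_le (hd : 3 ≤ d) (g : ℕ) :
    0 ≤ 1 / (((d : ℝ) - 1) * (d : ℝ) ^ g) ∧ 1 / (((d : ℝ) - 1) * (d : ℝ) ^ g) ≤ 1 := by
  have hD : (3 : ℝ) ≤ d := by exact_mod_cast hd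
  have h1 : (1 : ℝ) ≤ (d : ℝ) ^ g := one_le_pow₀ (by linarith)
  have h2 : (1 : ℝ) ≤ ((d : ℝ) - 1) * (d : ℝ) ^ g := by nlinarith
  exact ⟨by positivity, by rw [div_le_one (by linarith)]; exact h2⟩

lemma movingCost_succ_le (hd : 3 ≤ d) (g : ℕ) : movingCost d (g + 1) ≤ 1 / ((d : ℝ) - 1) := by
  induction g with
  | zero => simp [movingCost_succ, movingCost_zero]
  | succ g ih =>
    rw [movingCost_succ]
    exact (mul_le_of_le_one_right (movingCost_nonneg hd _) (movingCost_step_le hd _).2).trans ih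

lemma movingCost_le_one (hd : 3 ≤ d) (g : ℕ) : movingCost d g ≤ 1 := by
  have hD : (3 : ℝ) ≤ d := by exact_mod_cast hd
  cases g with
  | zero => rw [movingCost_zero]
  | succ g =>
    refine (movingCost_succ_le hd g).trans ?_
    rw [div_le_one (by linarith)]
    linarith

lemma pow_mul_movingCost_succ (hd : 3 ≤ d) (g : ℕ) :
    (d : ℝ) ^ (g + 1) * movingCost d (g + 2) =
      (d : ℝ) ^ g * movingCost d (g + 1) * (1 / ((d : ℝ) - 1)) / (d : ℝ) ^ g := by
  have hD : (3 : ℝ) ≤ d := by exact_mod_cast hd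
  have h1 : (d : ℝ) - 1 ≠ 0 := by linarith
  have h2 : (d : ℝ) ≠ 0 := by linarith
  rw [movingCost_succ d (g + 1)]
  field_simp

/-- Generation `g + 1` has `(d+1) * d ^ g` vertices, so this makes the total cost of a generation
decay geometrically. -/
lemma pow_mul_movingCost_le (hd : 3 ≤ d) (g : ℕ) :
    (d : ℝ) ^ g * movingCost d (g + 1) ≤ (1 / ((d : ℝ) - 1)) ^ (g + 1) := by
  have hD : (3 : ℝ) ≤ d := by exact_mod_cast hd
  have hd1 : (0 : ℝ) < (d : ℝ) - 1 := by linarith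
  induction g with
  | zero => simp [movingCost_succ, movingCost_zero]
  | succ g ih =>
    rw [pow_mul_movingCost_succ hd, pow_succ _ (g + 1)]
    refine (div_le_self ?_ (one_le_pow₀ (by linarith))).trans
      (mul_le_mul_of_nonneg_right ih (by positivity))
    have := movingCost_nonneg hd (g + 1)
    positivity

/-- The divisors in the last two recursion steps are at least `d` and `d ^ 2`. The gain `d ^ 3` is
what produces the constant 8 in the bound for two peaks far from the root. -/
lemma pow_mul_movingCost_le_div (hd : 3 ≤ d) (g : ℕ) :
    (d : ℝ) ^ (g + 3) * movingCost d (g + 4) ≤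
      (1 / ((d : ℝ) - 1)) ^ (g + 4) / (d : ℝ) ^ 3 := by
  have hD : (3 : ℝ) ≤ d := by exact_mod_cast hd
  have hd1 : (0 : ℝ) < (d : ℝ) - 1 := by linarith
  have h1 : (d : ℝ) ^ (g + 2) * movingCost d (g + 3) ≤ (1 / ((d : ℝ) - 1)) ^ (g + 3) / d := by
    rw [pow_mul_movingCost_succ hd, pow_succ _ (g + 2)]
    exact div_le_div₀ (by positivity)
      (mul_le_mul_of_nonneg_right (pow_mul_movingCost_le hd (g + 1)) (by positivity))
      (by positivity) (le_self_pow₀ (by linarith) (by omega))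
  have h2 : ∀ z : ℝ, z ^ (g + 4) / (d : ℝ) ^ 3 = z ^ (g + 3) / d * z / (d : ℝ) ^ 2 := by
    intro z
    have : (d : ℝ) ≠ 0 := by linarith
    field_simp
    ring
  rw [pow_mul_movingCost_succ hd, h2]
  exact div_le_div₀ (by positivity) (mul_le_mul_of_nonneg_right h1 (by positivity))
    (by positivity) (pow_le_pow_right₀ (by linarith) (by omega))

end MovingCost

/-! ### Upper bounds for the number of labelings with given peaks. -/

section TwinBounds

variable {V : Type u} [Fintype V] {G : SimpleGraph V} {r : V} {p : V → V} {d k : ℕ}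

lemma sum_range_one_div_pow_le {D : ℝ} (hD : 2 < D) (n : ℕ) :
    ∑ j ∈ Finset.range n, (1 / (D - 1)) ^ (n - (j + 1)) ≤ (D - 1) / (D - 2) := by
  have h0 : 0 ≤ 1 / (D - 1) := div_nonneg zero_le_one (by linarith)
  have h1 : 1 / (D - 1) < 1 := by
    rw [div_lt_one (by linarith)]
    linarith
  rw [← Finset.sum_range_reflect]
  have h2 : ∑ j ∈ Finset.range n, (1 / (D - 1)) ^ (n - (n - 1 - j + 1)) =
      ∑ j ∈ Finset.range n, (1 / (D - 1)) ^ j := by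
    refine Finset.sum_congr rfl fun j hj => ?_
    rw [Finset.mem_range] at hj
    congr 1
    omega
  rw [h2]
  refine ((summable_geometric_of_lt_one h0 h1).sum_le_tsum _ fun _ _ => pow_nonneg h0 _).trans ?_
  rw [tsum_geometric_of_lt_one h0 h1]
  have h3 : D - 1 ≠ 0 := by linarith
  have h4 : D - 2 ≠ 0 := by linarith
  refine le_of_eq ?_
  rw [inv_eq_one_div, div_eq_div_iff (by linarith) h4]
  field_simp
  ring

lemma natCast_mul_pow_le {z : ℝ} (h0 : 0 ≤ z) (h1 : z ≤ 1 / 2) (n : ℕ) :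
    ((n + 2 : ℕ) : ℝ) * z ^ (n + 2) ≤ 2 * z ^ 2 := by
  induction n with
  | zero => simp
  | succ n ih =>
    refine le_trans ?_ ih
    have h2 : 0 ≤ z ^ (n + 2) := pow_nonneg h0 _
    have h3 : z ^ (n + 1 + 2) = z ^ (n + 2) * z := by ring
    rw [h3]
    push_cast
    have h4 : ((n : ℝ) + 1 + 2) * z ≤ n + 2 := by
      have : (0 : ℝ) ≤ n := Nat.cast_nonneg n
      nlinarith
    nlinarith

lemma twinLabelings_eq_empty_of_adj {x y : V} (h : G.Adj x y) : twinLabelings G x y = ∅ := by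
  rw [Finset.eq_empty_iff_forall_notMem]
  intro L hL
  rw [mem_twinLabelings] at hL
  exact absurd ((hL.2 y).2 (Or.inr rfl) x h.symm) (not_lt.2 hL.1.le)

namespace IsParentMap

variable (H : IsParentMap G r p)
include H

open Classical in
/-- Summing over the edges that separate the two peaks. -/
lemma sum_cutLabelings_le (hd : 3 ≤ d) (x y : V) (t : V → V)
    (ht : ∀ q, q ≠ r → ¬ IsAncestor p q x → IsAncestor p q y →
      ((cutLabelings p q x y (t q)).card : ℝ) ≤ (rootedLabelings p r).card *
        (((d : ℝ) - 1) / (d - 2) * movingCost d (G.dist r x) *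
        (1 / ((d : ℝ) - 1)) ^ (G.dist r y - G.dist r q))) :
    ∑ q ∈ Finset.univ.filter (fun q => IsAncestor p q y ∧ q ≠ r),
        (if IsAncestor p q x then 0 else ((cutLabelings p q x y (t q)).card : ℝ)) ≤
      (rootedLabelings p r).card *
        ((((d : ℝ) - 1) / (d - 2)) ^ 2 * movingCost d (G.dist r x)) := by
  have hD : (3 : ℝ) ≤ d := by exact_mod_cast hd
  have hP : 0 ≤ ((d : ℝ) - 1) / (d - 2) := div_nonneg (by linarith) (by linarith)
  have hz : 0 ≤ 1 / ((d : ℝ) - 1) := div_nonneg zero_le_one (by linarith)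
  have hρ := movingCost_nonneg hd (G.dist r x)
  have hterm : ∀ q ∈ Finset.univ.filter (fun q => IsAncestor p q y ∧ q ≠ r),
      (if IsAncestor p q x then 0 else ((cutLabelings p q x y (t q)).card : ℝ)) ≤
      (rootedLabelings p r).card * (((d : ℝ) - 1) / (d - 2) * movingCost d (G.dist r x) *
        (1 / ((d : ℝ) - 1)) ^ (G.dist r y - G.dist r q)) := by
    intro q hq
    simp only [Finset.mem_filter, Finset.mem_univ, true_and] at hq
    split_ifs with h
    · positivity
    · exact ht q hq.2 h hq.1
  refine (Finset.sum_le_sum hterm).trans ?_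
  rw [H.sum_ancestors y (fun j => ((rootedLabelings p r).card : ℝ) *
    (((d : ℝ) - 1) / (d - 2) * movingCost d (G.dist r x) *
      (1 / ((d : ℝ) - 1)) ^ (G.dist r y - j))), ← Finset.mul_sum, ← Finset.mul_sum]
  refine mul_le_mul_of_nonneg_left ?_ (Nat.cast_nonneg _)
  refine (mul_le_mul_of_nonneg_left (sum_range_one_div_pow_le (by linarith) _)
    (mul_nonneg hP hρ)).trans (le_of_eq ?_)
  ring

/-- One factor `(d-1)/(d-2) ≤ 2` comes from the shrunken hooks and one from the sum over cut edges;
their product 4 is halved by the double counting. -/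
theorem card_twinLabelings_le (hT : IsRegularTree G r d k) (hk : 0 < k) (hd : 3 ≤ d) (x y : V) :
    ((twinLabelings G x y).card : ℝ) ≤ 2 * (rootedLabelings p r).card *
      (movingCost d (G.dist r x) + movingCost d (G.dist r y)) := by
  classical
  have hD : (3 : ℝ) ≤ d := by exact_mod_cast hd
  have hP : 0 ≤ ((d : ℝ) - 1) / (d - 2) := div_nonneg (by linarith) (by linarith)
  have hP2 : ((d : ℝ) - 1) / (d - 2) ≤ 2 := by
    rw [div_le_iff₀ (by linarith)]
    linarith
  have hP4 : (((d : ℝ) - 1) / (d - 2)) ^ 2 ≤ 4 := by nlinarith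
  have hz : 0 ≤ 1 / ((d : ℝ) - 1) := div_nonneg zero_le_one (by linarith)
  have h1 := (Nat.cast_le (α := ℝ)).2 (H.two_mul_card_twinLabelings_le x y)
  push_cast at h1
  have h2 := H.sum_cutLabelings_le hd x y (fun _ => r) fun q hq hx hy =>
    H.card_cutLabelings_top_root_le hT hk hd hq hx hy
  have h3 := H.sum_cutLabelings_le hd y x (fun q => q) fun q hq hx hy =>
    (H.card_cutLabelings_top_cut_le hT hk hd hq hx hy).trans <| by
      refine mul_le_mul_of_nonneg_left (mul_le_of_le_one_left ?_ ?_) (Nat.cast_nonneg _)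
      · have := movingCost_nonneg hd (G.dist r y)
        positivity
      · have : (1 : ℝ) ≤ (d : ℝ) ^ G.dist r q := one_le_pow₀ (by linarith)
        exact div_le_one_of_le₀ this (by positivity)
  have hS : (0 : ℝ) ≤ (rootedLabelings p r).card := Nat.cast_nonneg _
  have h4 := mul_le_mul_of_nonneg_left (mul_le_mul_of_nonneg_right hP4
    (movingCost_nonneg hd (G.dist r x))) hS
  have h5 := mul_le_mul_of_nonneg_left (mul_le_mul_of_nonneg_right hP4
    (movingCost_nonneg hd (G.dist r y))) hS
  linarith

/-- For large `d`, having the highest peak away from the root is strictly less likely. -/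
theorem card_twinLabelings_lt (hT : IsRegularTree G r d k) (hk : 0 < k) (hd : 10 ≤ d) {x : V}
    (hx : x ≠ r) (y : V) :
    ((twinLabelings G x y).card : ℝ) < (rootedLabelings p r).card / d := by
  classical
  have hD : (10 : ℝ) ≤ d := by exact_mod_cast hd
  have hS : (0 : ℝ) < (rootedLabelings p r).card := by exact_mod_cast H.card_rootedLabelings_pos
  have hd3 : 3 ≤ d := by omega
  have hz : 0 ≤ 1 / ((d : ℝ) - 1) := div_nonneg zero_le_one (by linarith)
  have hz2 : 1 / ((d : ℝ) - 1) ≤ 1 / 2 := one_div_le_one_div_of_le (by norm_num) (by linarith)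
  have hP : 0 ≤ ((d : ℝ) - 1) / (d - 2) := div_nonneg (by linarith) (by linarith)
  have hgx : G.dist r x ≠ 0 := fun h => hx (H.eq_root_of_dist h)
  have hρx : movingCost d (G.dist r x) ≤ 1 / ((d : ℝ) - 1) := by
    obtain ⟨g, hg⟩ := Nat.exists_eq_succ_of_ne_zero hgx
    rw [hg]
    exact movingCost_succ_le hd3 g
  have hρy0 := movingCost_nonneg hd3 (G.dist r y)
  by_cases hadj : G.Adj x y
  · rw [twinLabelings_eq_empty_of_adj hadj, Finset.card_empty, Nat.cast_zero]
    exact div_pos hS (by linarith)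
  -- At depth 1 a single power of `1/(d-1)` is not enough, but `y` is then not the root, because `x`
  -- and `y` are not adjacent, and its moving cost supplies the second power.
  have hsmall : (G.dist r x : ℝ) * (movingCost d (G.dist r y) *
      (1 / ((d : ℝ) - 1)) ^ (G.dist r x)) ≤ 2 * (1 / ((d : ℝ) - 1)) ^ 2 := by
    by_cases h1 : G.dist r x = 1
    · have hy : y ≠ r := by
        rintro rfl
        refine hadj ((H.adj_iff _ _).2 (Or.inl ⟨hx, H.eq_root_of_dist ?_⟩))
        have := H.dist_parent x hx
        omega
      have hgy : G.dist r y ≠ 0 := fun h => hy (H.eq_root_of_dist h)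
      obtain ⟨g, hg⟩ := Nat.exists_eq_succ_of_ne_zero hgy
      have hρy : movingCost d (G.dist r y) ≤ 1 / ((d : ℝ) - 1) := by
        rw [hg]
        exact movingCost_succ_le hd3 g
      rw [h1, Nat.cast_one, one_mul, pow_one]
      nlinarith
    · obtain ⟨n, hn⟩ : ∃ n, G.dist r x = n + 2 := ⟨G.dist r x - 2, by omega⟩
      have h2 := natCast_mul_pow_le hz hz2 n
      rw [← hn] at h2
      refine le_trans ?_ h2
      refine mul_le_mul_of_nonneg_left ?_ (Nat.cast_nonneg _)
      exact mul_le_of_le_one_left (by positivity) (movingCost_le_one hd3 _)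
  have h1 := (Nat.cast_le (α := ℝ)).2 (H.two_mul_card_twinLabelings_le x y)
  push_cast at h1
  have h2 := H.sum_cutLabelings_le hd3 x y (fun _ => r) fun q hq hx hy =>
    H.card_cutLabelings_top_root_le hT hk hd3 hq hx hy
  -- The power of `1/d` up to `q` and the power of `1/(d-1)` from `q` to `x` combine to a bound
  -- independent of `q`, so the sum only contributes the number of terms, the depth of `x`.
  have h3 : ∑ q ∈ Finset.univ.filter (fun q => IsAncestor p q x ∧ q ≠ r),
      (if IsAncestor p q y then 0 else ((cutLabelings p q y x q).card : ℝ)) ≤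
      ((rootedLabelings p r).card : ℝ) * (((d : ℝ) - 1) / (d - 2) *
        (2 * (1 / ((d : ℝ) - 1)) ^ 2)) := by
    have hterm : ∀ q ∈ Finset.univ.filter (fun q => IsAncestor p q x ∧ q ≠ r),
        (if IsAncestor p q y then 0 else ((cutLabelings p q y x q).card : ℝ)) ≤
        ((rootedLabelings p r).card : ℝ) * (((d : ℝ) - 1) / (d - 2) *
          (movingCost d (G.dist r y) * (1 / ((d : ℝ) - 1)) ^ (G.dist r x))) := by
      intro q hq
      simp only [Finset.mem_filter, Finset.mem_univ, true_and] at hq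
      split_ifs with h
      · positivity
      · refine (H.card_cutLabelings_top_cut_le hT hk hd3 hq.2 h hq.1).trans ?_
        refine mul_le_mul_of_nonneg_left ?_ hS.le
        have h4 : 1 / (d : ℝ) ^ G.dist r q ≤ (1 / ((d : ℝ) - 1)) ^ G.dist r q := by
          rw [one_div_pow]
          exact one_div_le_one_div_of_le (pow_pos (by linarith) _)
            (pow_le_pow_left₀ (by linarith) (by linarith) _)
        have h5 : (1 / ((d : ℝ) - 1)) ^ (G.dist r x) = (1 / ((d : ℝ) - 1)) ^ G.dist r q *
            (1 / ((d : ℝ) - 1)) ^ (G.dist r x - G.dist r q) := by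
          rw [← pow_add, Nat.add_sub_cancel' (H.dist_le_of_isAncestor hq.1)]
        rw [h5]
        refine (mul_le_mul_of_nonneg_right h4 (by positivity)).trans (le_of_eq ?_)
        ring
    refine (Finset.sum_le_sum hterm).trans ?_
    rw [H.sum_ancestors x (fun _ => ((rootedLabelings p r).card : ℝ) *
      (((d : ℝ) - 1) / (d - 2) * (movingCost d (G.dist r y) *
        (1 / ((d : ℝ) - 1)) ^ (G.dist r x)))), Finset.sum_const, Finset.card_range, nsmul_eq_mul]
    have := mul_le_mul_of_nonneg_left hsmall (mul_nonneg hS.le hP)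
    linarith
  -- After clearing denominators this reads `0 < d³ - 10d² + 19d - 8`, which is where `10 ≤ d`
  -- enters.
  have h6 : ((d : ℝ) - 1) / (d - 2) * (((d : ℝ) - 1) / (d - 2) * (1 / ((d : ℝ) - 1))) +
      ((d : ℝ) - 1) / (d - 2) * (2 * (1 / ((d : ℝ) - 1)) ^ 2) < 2 / d := by
    have e1 : (0 : ℝ) < (d : ℝ) - 1 := by linarith
    have e2 : (0 : ℝ) < (d : ℝ) - 2 := by linarith
    have e3 : (0 : ℝ) < (d : ℝ) := by linarith
    have : ((d : ℝ) - 1) / (d - 2) * (((d : ℝ) - 1) / (d - 2) * (1 / ((d : ℝ) - 1))) +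
      ((d : ℝ) - 1) / (d - 2) * (2 * (1 / ((d : ℝ) - 1)) ^ 2) =
      (((d : ℝ) - 1) ^ 2 + 2 * (d - 2)) / ((d - 2) ^ 2 * (d - 1)) := by
      field_simp
    rw [this, div_lt_div_iff₀ (by positivity) e3]
    nlinarith [mul_nonneg (mul_nonneg e3.le e3.le) (sub_nonneg.2 hD)]
  have h7 := mul_lt_mul_of_pos_left h6 hS
  have h8 := mul_le_mul_of_nonneg_left (mul_le_mul_of_nonneg_left hρx (sq_nonneg
    (((d : ℝ) - 1) / (d - 2)))) hS.le
  have h9 : ((rootedLabelings p r).card : ℝ) * (2 / d) = 2 * ((rootedLabelings p r).card / d) := by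
    ring
  rw [h9] at h7
  nlinarith

open Classical in
lemma sum_dist_eq (hT : IsRegularTree G r d k) (f : ℕ → ℝ) :
    ∑ x, f (G.dist r x) =
      f 0 + ∑ g ∈ Finset.range k, ((d : ℝ) + 1) * (d : ℝ) ^ g * f (g + 1) := by
  rw [← Finset.sum_fiberwise_of_maps_to (g := G.dist r) (t := Finset.range (k + 1))
    (fun x _ => Finset.mem_range.2 (Nat.lt_succ_of_le (hT.depth_le x))), Finset.sum_range_succ',
    add_comm]
  congr 1
  · have : Finset.univ.filter (fun u => G.dist r u = 0) = {r} := by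
      ext u
      simp only [Finset.mem_filter, Finset.mem_univ, true_and, Finset.mem_singleton]
      exact ⟨H.eq_root_of_dist, fun h => by simp [h]⟩
    rw [this, Finset.sum_singleton, SimpleGraph.dist_self]
  · refine Finset.sum_congr rfl fun g hg => ?_
    rw [Finset.sum_congr rfl (g := fun _ => f (g + 1)), Finset.sum_const,
      H.card_generation hT (Finset.mem_range.1 hg), nsmul_eq_mul]
    · push_cast
      ring
    · intro x hx
      rw [(Finset.mem_filter.1 hx).2]

end IsParentMap

end TwinBounds

/-! ### From counts to conditional probabilities. -/

section Probability

variable {V : Type u} [Fintype V]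

lemma mem_inter_peakPairEvent_iff (G : SimpleGraph V) (R : V → V → Prop) (L : Labeling V) :
    L ∈ peakCountEvent G 2 ∩ peakPairEvent G R ↔ ∃ x y, R x y ∧ L ∈ twinLabelings G x y := by
  constructor
  · rintro ⟨hE, x, y, hx, hy, hR⟩
    refine ⟨x, y, hR, ?_⟩
    obtain ⟨z, hz⟩ := Set.ncard_eq_one.1 hy.2
    have hz' : IsPeak G L z ∧ L y < L z := by
      have : z ∈ {w | IsPeak G L w ∧ L y < L w} := by
        rw [hz]
        exact Set.mem_singleton z
      exact this
    have hlt : L y < L x := hz'.2.trans_le (hx.2 z hz'.1)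
    have hne : x ≠ y := by
      rintro rfl
      exact lt_irrefl _ hlt
    have hset : ({x, y} : Set V) = {v | IsPeak G L v} := by
      refine Set.eq_of_subset_of_ncard_le ?_ ?_ (Set.toFinite _)
      · rintro w (rfl | rfl)
        · exact hx.1
        · exact hy.1
      · rw [Set.ncard_pair hne]
        exact le_of_eq hE
    rw [mem_twinLabelings]
    refine ⟨hlt, fun v => ?_⟩
    have : v ∈ ({x, y} : Set V) ↔ IsPeak G L v := by
      rw [hset]
      rfl
    exact this.symm
  · rintro ⟨x, y, hR, hL⟩
    rw [mem_twinLabelings] at hL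
    have hne : x ≠ y := by
      rintro rfl
      exact lt_irrefl _ hL.1
    refine ⟨?_, x, y, ⟨(hL.2 x).2 (Or.inl rfl), ?_⟩, ⟨(hL.2 y).2 (Or.inr rfl), ?_⟩, hR⟩
    · have : {v | IsPeak G L v} = {x, y} := by
        ext v
        exact hL.2 v
      change {v | IsPeak G L v}.ncard = 2
      rw [this, Set.ncard_pair hne]
    · intro v hv
      rcases (hL.2 v).1 hv with rfl | rfl
      · exact le_rfl
      · exact hL.1.le
    · have : {v | IsPeak G L v ∧ L y < L v} = {x} := by
        ext v
        change IsPeak G L v ∧ L y < L v ↔ v = x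
        rw [hL.2]
        constructor
        · rintro ⟨h | h, h'⟩
          · exact h
          · rw [h] at h'
            exact absurd h' (lt_irrefl _)
        · rintro rfl
          exact ⟨Or.inl rfl, hL.1⟩
      rw [this, Set.ncard_singleton]

lemma exists_mem_twinLabelings {G : SimpleGraph V} {L : Labeling V} (hL : L ∈ peakCountEvent G 2) :
    ∃ x y, L ∈ twinLabelings G x y := by
  obtain ⟨a, b, hab, hset⟩ := Set.ncard_eq_two.1 hL
  have hiff : ∀ v, IsPeak G L v ↔ v = a ∨ v = b := by
    intro v
    have : v ∈ {v | IsPeak G L v} ↔ v ∈ ({a, b} : Set V) := by rw [hset]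
    exact this
  rcases lt_trichotomy (L a) (L b) with h | h | h
  · exact ⟨b, a, mem_twinLabelings.2 ⟨h, fun v => (hiff v).trans or_comm⟩⟩
  · exact absurd (L.injective h) hab
  · exact ⟨a, b, mem_twinLabelings.2 ⟨h, hiff⟩⟩

lemma twinLabelings_disjoint (G : SimpleGraph V) {x y x' y' : V} (h : (x, y) ≠ (x', y')) :
    Disjoint (twinLabelings G x y) (twinLabelings G x' y') := by
  rw [Finset.disjoint_left]
  intro L hL hL'
  rw [mem_twinLabelings] at hL hL'
  have h1 := (hL'.2 x).1 ((hL.2 x).2 (Or.inl rfl))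
  have h2 := (hL'.2 y).1 ((hL.2 y).2 (Or.inr rfl))
  rcases h1 with rfl | rfl <;> rcases h2 with rfl | rfl
  · exact lt_irrefl _ hL.1
  · exact h rfl
  · exact lt_asymm hL.1 hL'.1
  · exact lt_irrefl _ hL.1

open Classical in
/-- The number of labelings with exactly two peaks whose locations satisfy `R`. -/
noncomputable def twinCount (G : SimpleGraph V) (R : V → V → Prop) : ℝ :=
  ∑ x, ∑ y, if R x y then ((twinLabelings G x y).card : ℝ) else 0

lemma ncard_inter_peakPairEvent (G : SimpleGraph V) (R : V → V → Prop) :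
    ((peakCountEvent G 2 ∩ peakPairEvent G R).ncard : ℝ) = twinCount G R := by
  classical
  have h : peakCountEvent G 2 ∩ peakPairEvent G R =
      ((Finset.univ.filter (fun z : V × V => R z.1 z.2)).biUnion
        (fun z => twinLabelings G z.1 z.2) : Finset (Labeling V)) := by
    ext L
    rw [mem_inter_peakPairEvent_iff]
    simp
  rw [h, Set.ncard_coe_finset, Finset.card_biUnion]
  · rw [twinCount, ← Finset.univ_product_univ, Finset.sum_filter, Finset.sum_product]
    push_cast
    rfl
  · intro z _ z' _ hne
    exact twinLabelings_disjoint G hne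

theorem twinPeaksProb_eq_div (G : SimpleGraph V) (R : V → V → Prop) :
    twinPeaksProb G R = twinCount G R / twinCount G (fun _ _ => True) := by
  classical
  have hE : peakCountEvent G 2 = peakCountEvent G 2 ∩ peakPairEvent G (fun _ _ => True) := by
    ext L
    rw [mem_inter_peakPairEvent_iff]
    refine ⟨fun h => ?_, ?_⟩
    · obtain ⟨x, y, h⟩ := exists_mem_twinLabelings h
      exact ⟨x, y, trivial, h⟩
    · rintro ⟨x, y, _, h⟩
      exact ((mem_inter_peakPairEvent_iff G (fun _ _ => True) L).2 ⟨x, y, trivial, h⟩).1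
  have hμ : ∀ s : Set (Labeling V),
      (labelingLaw V s).toReal = (s.ncard : ℝ) / Fintype.card (Labeling V) := by
    intro s
    rw [labelingLaw, uniformOn_univ, ENNReal.toReal_div, Measure.count_apply (by measurability)]
    rw [Set.encard_eq_coe_toFinset_card, Set.ncard_eq_toFinset_card']
    simp
  have hN : (Fintype.card (Labeling V) : ℝ) ≠ 0 := by
    have : Nonempty (Labeling V) := ⟨Fintype.equivFin V⟩
    exact_mod_cast Fintype.card_ne_zero
  rw [twinPeaksProb, twinPeaksLaw, measureReal_def, cond_apply (by measurability),
    ENNReal.toReal_mul, ENNReal.toReal_inv, hμ, hμ, ncard_inter_peakPairEvent, hE,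
    ncard_inter_peakPairEvent]
  rw [inv_div, div_mul_div_comm, mul_comm, mul_div_mul_right _ _ hN]

lemma twinCount_singleton (G : SimpleGraph V) (x y : V) :
    twinCount G (fun K₁ K₂ => K₁ = x ∧ K₂ = y) = (twinLabelings G x y).card := by
  classical
  rw [twinCount, Finset.sum_eq_single x, Finset.sum_eq_single y]
  · simp
  · intro b _ hb
    simp [hb]
  · simp
  · intro b _ hb
    simp [hb]
  · simp

lemma twinCount_le_of_imp (G : SimpleGraph V) {R R₁ R₂ : V → V → Prop}
    (h : ∀ x y, R x y → R₁ x y ∨ R₂ x y) : twinCount G R ≤ twinCount G R₁ + twinCount G R₂ := by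
  classical
  unfold twinCount
  rw [← Finset.sum_add_distrib]
  refine Finset.sum_le_sum fun x _ => ?_
  rw [← Finset.sum_add_distrib]
  refine Finset.sum_le_sum fun y _ => ?_
  have h0 : (0 : ℝ) ≤ (twinLabelings G x y).card := Nat.cast_nonneg _
  by_cases h1 : R x y
  · rcases h x y h1 with h2 | h2
    · rw [if_pos h1, if_pos h2]
      split_ifs <;> linarith
    · rw [if_pos h1, if_pos h2]
      split_ifs <;> linarith
  · rw [if_neg h1]
    split_ifs <;> linarith

variable {G : SimpleGraph V} {r : V} {p : V → V} {d k : ℕ}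

namespace IsParentMap

variable (H : IsParentMap G r p)
include H

open Classical in
lemma twinCount_le (hT : IsRegularTree G r d k) (hk : 0 < k) (hd : 3 ≤ d) (P : V → Prop) :
    twinCount G (fun x y => P x ∧ P y) ≤ 4 * (rootedLabelings p r).card *
      ((Finset.univ.filter P).card * ∑ x, if P x then movingCost d (G.dist r x) else 0) := by
  have h1 : twinCount G (fun x y => P x ∧ P y) ≤
      ∑ x ∈ Finset.univ.filter P, ∑ y ∈ Finset.univ.filter P, 2 * ((rootedLabelings p r).card : ℝ) *
        (movingCost d (G.dist r x) + movingCost d (G.dist r y)) := by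
    rw [twinCount, Finset.sum_filter]
    refine Finset.sum_le_sum fun x _ => ?_
    split_ifs with hx
    · rw [Finset.sum_filter]
      refine Finset.sum_le_sum fun y _ => ?_
      by_cases hy : P y
      · rw [if_pos ⟨hx, hy⟩, if_pos hy]
        exact H.card_twinLabelings_le hT hk hd x y
      · rw [if_neg (fun h => hy h.2), if_neg hy]
    · refine (Finset.sum_eq_zero fun y _ => ?_).le
      rw [if_neg (fun h => hx h.1)]
  refine h1.trans (le_of_eq ?_)
  rw [← Finset.sum_filter]
  simp only [← Finset.mul_sum, Finset.sum_add_distrib, Finset.sum_const, nsmul_eq_mul]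
  ring

-- Pairs with the highest peak at the root already suffice as a lower bound for the normalising
-- constant.
open Classical in
lemma le_twinCount_true (hT : IsRegularTree G r d k) (hd : 3 ≤ d) :
    ((Finset.univ.filter (fun y => 2 ≤ G.dist r y)).card : ℝ) *
      ((rootedLabelings p r).card / d) ≤ twinCount G (fun _ _ => True) := by
  rw [← nsmul_eq_mul, ← Finset.sum_const, twinCount]
  simp only [if_true]
  refine le_trans ?_ (Finset.single_le_sum (f := fun x => ∑ y, ((twinLabelings G x y).card : ℝ))
    (fun x _ => Finset.sum_nonneg fun y _ => Nat.cast_nonneg _) (Finset.mem_univ r))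
  rw [Finset.sum_filter]
  refine Finset.sum_le_sum fun y _ => ?_
  split_ifs with h
  · exact H.card_twinLabelings_root_ge hT hd h
  · exact Nat.cast_nonneg _

open Classical in
lemma pow_le_card_two_le_dist (hT : IsRegularTree G r d k) (hk : 2 ≤ k) :
    (d : ℝ) ^ k ≤ (Finset.univ.filter (fun y => 2 ≤ G.dist r y)).card := by
  have h1 := H.card_generation hT (g := k - 1) (by omega)
  rw [show k - 1 + 1 = k by omega] at h1
  have h2 : (Finset.univ.filter (fun v => G.dist r v = k)).card ≤
      (Finset.univ.filter (fun y => 2 ≤ G.dist r y)).card := by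
    refine Finset.card_le_card fun v hv => ?_
    simp only [Finset.mem_filter, Finset.mem_univ, true_and] at hv ⊢
    omega
  have h3 : d ^ k ≤ (d + 1) * d ^ (k - 1) := by
    conv_lhs => rw [show k = k - 1 + 1 by omega, pow_succ']
    exact Nat.mul_le_mul_right _ (Nat.le_succ d)
  exact_mod_cast h3.trans (h1.symm.le.trans h2)

lemma twinCount_true_pos (hT : IsRegularTree G r d k) (hk : 2 ≤ k) (hd : 3 ≤ d) :
    0 < twinCount G (fun _ _ => True) := by
  have hd0 : (0 : ℝ) < d := by exact_mod_cast (by omega : 0 < d)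
  have hS : (0 : ℝ) < (rootedLabelings p r).card := by exact_mod_cast H.card_rootedLabelings_pos
  refine lt_of_lt_of_le ?_ (H.le_twinCount_true hT hd)
  exact mul_pos (lt_of_lt_of_le (by positivity) (H.pow_le_card_two_le_dist hT hk)) (by positivity)

/-- The probability that both peaks are far from the root. -/
theorem twinPeaksProb_far_le (hT : IsRegularTree G r d k) (hk : 2 ≤ k) (hd : 3 ≤ d) {m : ℝ}
    (hm : 4 ≤ m) :
    twinPeaksProb G (fun x y => m ≤ G.dist r x ∧ m ≤ G.dist r y) ≤
      8 * Real.exp (-((m / 2) * Real.log ((d : ℝ) - 1))) := by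
  classical
  have hD : (3 : ℝ) ≤ d := by exact_mod_cast hd
  have hS : (0 : ℝ) < (rootedLabelings p r).card := by exact_mod_cast H.card_rootedLabelings_pos
  have hlog : 0 < Real.log ((d : ℝ) - 1) := Real.log_pos (by linarith)
  -- `E t` is `(d-1)` to the power `-t/2`. Of the decay `E n * E n` in generation `n ≥ m`, one
  -- factor gives the claimed bound `E m` and the other one a convergent series.
  set E : ℝ → ℝ := fun t => Real.exp (-((t / 2) * Real.log ((d : ℝ) - 1))) with hE
  have hEz : ∀ n : ℕ, (1 / ((d : ℝ) - 1)) ^ n = E n * E n := by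
    intro n
    simp only [hE]
    rw [← Real.exp_add, ← Real.exp_log (x := 1 / ((d : ℝ) - 1)) (div_pos one_pos (by linarith)),
      ← Real.exp_nat_mul, one_div, Real.log_inv]
    congr 1
    ring
  have hEpow : ∀ n : ℕ, E n = E 1 ^ n := by
    intro n
    simp only [hE]
    rw [← Real.exp_nat_mul]
    congr 1
    ring
  have hE0 : ∀ t, 0 < E t := fun t => Real.exp_pos _
  -- `E 1 * E 1 ≤ 1/2`; the value `3/4` bounds the geometric series below by 3.
  have hE1 : E 1 ≤ 3 / 4 := by
    have h1 := hEz 1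
    rw [pow_one, Nat.cast_one] at h1
    have h2 : 1 / ((d : ℝ) - 1) ≤ 1 / 2 := one_div_le_one_div_of_le (by norm_num) (by linarith)
    have h3 := hE0 1
    nlinarith
  have hEanti : ∀ s t, s ≤ t → E t ≤ E s := by
    intro s t hst
    simp only [hE]
    refine Real.exp_le_exp.2 ?_
    nlinarith
  have hsum : ∑ x, (if m ≤ G.dist r x then movingCost d (G.dist r x) else 0) ≤
      ((d : ℝ) + 1) / d ^ 3 * (3 * E m) := by
    rw [H.sum_dist_eq hT (fun g => if m ≤ (g : ℝ) then movingCost d g else 0),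
      if_neg (by push_cast; linarith), zero_add]
    have hterm : ∀ g ∈ Finset.range k, ((d : ℝ) + 1) * (d : ℝ) ^ g *
        (if m ≤ ((g + 1 : ℕ) : ℝ) then movingCost d (g + 1) else 0) ≤
        ((d : ℝ) + 1) / d ^ 3 * (E m * E 1 ^ (g + 1)) := by
      intro g _
      have hpos := hE0 m
      have hpos1 := hE0 1
      split_ifs with h
      · obtain ⟨j, rfl⟩ : ∃ j, g = j + 3 := by
          refine ⟨g - 3, ?_⟩
          have : (4 : ℝ) ≤ ((g + 1 : ℕ) : ℝ) := hm.trans h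
          have : 4 ≤ g + 1 := by exact_mod_cast this
          omega
        have h1 := pow_mul_movingCost_le_div hd j
        have h2 : (1 / ((d : ℝ) - 1)) ^ (j + 4) ≤ E m * E 1 ^ (j + 4) := by
          rw [hEz, ← hEpow]
          exact mul_le_mul_of_nonneg_right (hEanti _ _ h) (hE0 _).le
        have h3 : (d : ℝ) ^ (j + 3) * movingCost d (j + 4) ≤ E m * E 1 ^ (j + 4) / d ^ 3 :=
          h1.trans (div_le_div_of_nonneg_right h2 (by positivity))
        have h4 := mul_le_mul_of_nonneg_left h3 (by linarith : (0 : ℝ) ≤ (d : ℝ) + 1)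
        calc _ = ((d : ℝ) + 1) * ((d : ℝ) ^ (j + 3) * movingCost d (j + 4)) := by ring
          _ ≤ _ := h4
          _ = _ := by ring
      · rw [mul_zero]
        positivity
    refine (Finset.sum_le_sum hterm).trans ?_
    rw [← Finset.mul_sum, ← Finset.mul_sum]
    refine mul_le_mul_of_nonneg_left ?_ (by positivity)
    rw [mul_comm 3]
    refine mul_le_mul_of_nonneg_left ?_ (hE0 m).le
    refine (sum_range_pow_succ_le (hE0 1).le (by linarith) k).trans ?_
    rw [div_le_iff₀ (by linarith)]
    linarith
  rw [twinPeaksProb_eq_div, div_le_iff₀ (H.twinCount_true_pos hT hk hd)]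
  have hnum := H.twinCount_le hT (by omega) hd (fun x => m ≤ G.dist r x)
  have hden := H.le_twinCount_true hT hd
  have hcard : ((Finset.univ.filter (fun x => m ≤ G.dist r x)).card : ℝ) ≤
      (Finset.univ.filter (fun y => 2 ≤ G.dist r y)).card := by
    refine Nat.cast_le.2 (Finset.card_le_card fun v hv => ?_)
    simp only [Finset.mem_filter, Finset.mem_univ, true_and] at hv ⊢
    have : (2 : ℝ) ≤ (G.dist r v : ℝ) := by linarith
    exact_mod_cast this
  set M : ℝ := ((Finset.univ.filter (fun y => 2 ≤ G.dist r y)).card : ℝ)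
  set S : ℝ := ((rootedLabelings p r).card : ℝ)
  have hM : 0 ≤ M := Nat.cast_nonneg _
  have hEm := hE0 m
  have h1 : 4 * S * (M * (((d : ℝ) + 1) / d ^ 3 * (3 * E m))) ≤ 8 * E m * (M * (S / d)) := by
    -- Here `12 = 4 * 3`, from `twinCount_le` and the geometric series; the claim is `12(d+1) ≤
    -- 8d²`.
    have h2 : 12 * (((d : ℝ) + 1) / d ^ 3) ≤ 8 * (1 / d) := by
      rw [mul_div_assoc', mul_one_div, div_le_div_iff₀ (by positivity) (by linarith)]
      nlinarith [mul_nonneg (by linarith : (0 : ℝ) ≤ d) (sub_nonneg.2 hD)]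
    have h3 := mul_le_mul_of_nonneg_right h2 (mul_nonneg (mul_nonneg hS.le hM) hEm.le)
    calc _ = 12 * (((d : ℝ) + 1) / d ^ 3) * (S * M * E m) := by ring
      _ ≤ _ := h3
      _ = _ := by ring
  refine hnum.trans (le_trans ?_ (h1.trans (mul_le_mul_of_nonneg_left hden (by positivity))))
  refine mul_le_mul_of_nonneg_left (mul_le_mul hcard hsum ?_ hM) (by positivity)
  refine Finset.sum_nonneg fun x _ => ?_
  split_ifs
  · exact movingCost_nonneg hd _
  · exact le_rfl

end IsParentMap

end Probability

/-! ### Peaks far from the leaves. -/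

section Main

namespace IsParentMap

variable {V : Type u} [Fintype V] {G : SimpleGraph V} {r : V} {p : V → V} {d k : ℕ}
variable (H : IsParentMap G r p)
include H

/-- The root contributes 1 and the other generations at most `(d+1)/(d-2) ≤ 4`. -/
lemma sum_movingCost_le (hT : IsRegularTree G r d k) (hd : 3 ≤ d) :
    ∑ x, movingCost d (G.dist r x) ≤ 5 := by
  have hD : (3 : ℝ) ≤ d := by exact_mod_cast hd
  have hz0 : 0 ≤ 1 / ((d : ℝ) - 1) := div_nonneg zero_le_one (by linarith)
  have hz1 : 1 / ((d : ℝ) - 1) < 1 := by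
    rw [div_lt_one (by linarith)]
    linarith
  rw [H.sum_dist_eq hT (movingCost d), movingCost_zero]
  have hterm : ∀ g ∈ Finset.range k, ((d : ℝ) + 1) * (d : ℝ) ^ g * movingCost d (g + 1) ≤
      ((d : ℝ) + 1) * (1 / ((d : ℝ) - 1)) ^ (g + 1) := by
    intro g _
    rw [mul_assoc]
    exact mul_le_mul_of_nonneg_left (pow_mul_movingCost_le hd g) (by linarith)
  have h1 := Finset.sum_le_sum hterm
  rw [← Finset.mul_sum] at h1
  have h2 := mul_le_mul_of_nonneg_left (sum_range_pow_succ_le hz0 hz1 k)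
    (by linarith : (0 : ℝ) ≤ (d : ℝ) + 1)
  have h3 : 1 / ((d : ℝ) - 1) / (1 - 1 / ((d : ℝ) - 1)) = 1 / ((d : ℝ) - 2) := by
    have e1 : (d : ℝ) - 1 ≠ 0 := by linarith
    have e2 : (d : ℝ) - 2 ≠ 0 := by linarith
    rw [one_sub_div e1, div_div_div_cancel_right₀ e1]
    congr 1
    ring
  rw [h3] at h2
  have h4 : ((d : ℝ) + 1) * (1 / ((d : ℝ) - 2)) ≤ 4 := by
    rw [mul_one_div, div_le_iff₀ (by linarith)]
    linarith
  linarith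

open Classical in
lemma card_dist_le_le (hT : IsRegularTree G r d k) (hd : 3 ≤ d) (t : ℝ) :
    ((Finset.univ.filter (fun x => (G.dist r x : ℝ) ≤ t)).card : ℝ) ≤
      ((d : ℝ) + 2) * Real.exp (t * Real.log d) := by
  have hD : (3 : ℝ) ≤ d := by exact_mod_cast hd
  by_cases ht : t < 0
  · have : Finset.univ.filter (fun x => (G.dist r x : ℝ) ≤ t) = ∅ := by
      rw [Finset.filter_eq_empty_iff]
      intro x _ h
      exact absurd (h.trans_lt ht) (not_lt.2 (Nat.cast_nonneg _))
    rw [this, Finset.card_empty, Nat.cast_zero]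
    positivity
  push Not at ht
  have hcard : ((Finset.univ.filter (fun x => (G.dist r x : ℝ) ≤ t)).card : ℝ) =
      ∑ x, if (G.dist r x : ℝ) ≤ t then (1 : ℝ) else 0 := by
    rw [Finset.sum_boole]
  rw [hcard, H.sum_dist_eq hT (fun g => if (g : ℝ) ≤ t then (1 : ℝ) else 0)]
  have hgeom : ∀ J : ℕ, ∑ g ∈ Finset.range J, (d : ℝ) ^ g ≤ (d : ℝ) ^ J := by
    intro J
    induction J with
    | zero => simp
    | succ J ih =>
      rw [Finset.sum_range_succ, pow_succ]
      have : (0 : ℝ) ≤ (d : ℝ) ^ J := by positivity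
      nlinarith
  have hfloor : (d : ℝ) ^ ⌊t⌋₊ ≤ Real.exp (t * Real.log d) := by
    rw [← Real.exp_log (x := (d : ℝ)) (by linarith), ← Real.exp_nat_mul, Real.log_exp]
    exact Real.exp_le_exp.2 (mul_le_mul_of_nonneg_right (Nat.floor_le ht)
      (Real.log_nonneg (by linarith)))
  have hsum : ∑ g ∈ Finset.range k, ((d : ℝ) + 1) * (d : ℝ) ^ g *
      (if ((g + 1 : ℕ) : ℝ) ≤ t then (1 : ℝ) else 0) ≤ ((d : ℝ) + 1) * (d : ℝ) ^ ⌊t⌋₊ := by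
    refine le_trans ?_ (mul_le_mul_of_nonneg_left (hgeom ⌊t⌋₊) (by linarith))
    simp only [mul_ite, mul_one, mul_zero]
    rw [← Finset.sum_filter, ← Finset.mul_sum]
    refine mul_le_mul_of_nonneg_left ?_ (by linarith)
    refine Finset.sum_le_sum_of_subset_of_nonneg ?_ fun _ _ _ => by positivity
    intro g hg
    rw [Finset.mem_range]
    exact Nat.lt_of_succ_le (Nat.le_floor (Finset.mem_filter.1 hg).2)
  have hone : (1 : ℝ) ≤ (d : ℝ) ^ ⌊t⌋₊ := one_le_pow₀ (by linarith)
  simp only [Nat.cast_zero, ht, if_true]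
  nlinarith

/-- The probability that both peaks are far from the leaves. -/
theorem twinPeaksProb_near_le (hT : IsRegularTree G r d k) (hk : 2 ≤ k) (hd : 3 ≤ d) (n : ℝ) :
    twinPeaksProb G (fun x y => (G.dist r x : ℝ) ≤ k - n / 2 ∧ (G.dist r y : ℝ) ≤ k - n / 2) ≤
      20 * ((d : ℝ) + 2) * d * Real.exp (-((n / 2) * Real.log d)) := by
  classical
  have hD : (3 : ℝ) ≤ d := by exact_mod_cast hd
  have hS : (0 : ℝ) < (rootedLabelings p r).card := by exact_mod_cast H.card_rootedLabelings_pos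
  rw [twinPeaksProb_eq_div, div_le_iff₀ (H.twinCount_true_pos hT hk hd)]
  have hnum := H.twinCount_le hT (by omega) hd (fun x => (G.dist r x : ℝ) ≤ k - n / 2)
  have hden := H.le_twinCount_true hT hd
  have hcard := H.card_dist_le_le hT hd (k - n / 2)
  have hsum : ∑ x, (if (G.dist r x : ℝ) ≤ k - n / 2 then movingCost d (G.dist r x) else 0) ≤ 5 := by
    refine (Finset.sum_le_sum fun x _ => ?_).trans (H.sum_movingCost_le hT hd)
    split_ifs
    · exact le_rfl
    · exact movingCost_nonneg hd _
  have hsum0 : 0 ≤ ∑ x, (if (G.dist r x : ℝ) ≤ k - n / 2 then movingCost d (G.dist r x) else 0) :=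
    Finset.sum_nonneg fun x _ => by
      split_ifs
      · exact movingCost_nonneg hd _
      · exact le_rfl
  have hexp : Real.exp ((k - n / 2) * Real.log d) =
      (d : ℝ) ^ k * Real.exp (-((n / 2) * Real.log d)) := by
    rw [← Real.exp_log (x := (d : ℝ)) (by linarith), ← Real.exp_nat_mul, Real.log_exp,
      ← Real.exp_add]
    congr 1
    ring
  have hM := H.pow_le_card_two_le_dist hT hk
  rw [hexp] at hcard
  -- The factor `d ^ k`, the order of the number of leaves, cancels against the one in `hexp`. The
  -- constant 20 is 4 from `twinCount_le` times the total moving cost 5.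
  have h1 : (d : ℝ) ^ k * ((rootedLabelings p r).card / d) ≤ twinCount G (fun _ _ => True) :=
    (mul_le_mul_of_nonneg_right hM (by positivity)).trans hden
  refine hnum.trans (le_trans (mul_le_mul_of_nonneg_left
    (mul_le_mul hcard hsum hsum0 (by positivity)) (by positivity)) ?_)
  refine le_trans (le_of_eq ?_) (mul_le_mul_of_nonneg_left h1 (by positivity))
  have : (d : ℝ) ≠ 0 := by linarith
  field_simp
  ring

end IsParentMap

lemma two_mul_log_sub_one_ge {d : ℕ} (hd : 3 ≤ d) :
    Real.log (d : ℝ) ≤ 2 * Real.log ((d : ℝ) - 1) := by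
  have hD : (3 : ℝ) ≤ d := by exact_mod_cast hd
  rw [← Nat.cast_ofNat, ← Real.log_pow]
  refine Real.log_le_log (by linarith) ?_
  nlinarith

end Main

/-! ### Assembly of the four statements. -/

theorem theorem7p2 :
    -- (a)
    (∀ d k : ℕ, 10 ≤ d → 2 ≤ k →
      ∀ (V : Type u) [Fintype V] (G : SimpleGraph V) (r : V), IsRegularTree G r d k →
        ∀ y₁ y₂ : V,
          (∀ z₁ z₂ : V,
            twinPeaksProb G (fun K₁ K₂ => K₁ = z₁ ∧ K₂ = z₂) ≤
              twinPeaksProb G (fun K₁ K₂ => K₁ = y₁ ∧ K₂ = y₂)) →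
          y₁ = r) ∧
    -- (b)
    (∀ d k : ℕ, 3 ≤ d → 2 ≤ k → ∀ m : ℝ, √(8 * (k : ℝ)) ≤ m →
      ∀ (V : Type u) [Fintype V] (G : SimpleGraph V) (r : V), IsRegularTree G r d k →
        twinPeaksProb G (fun K₁ K₂ => m ≤ min (G.dist K₁ r : ℝ) (G.dist K₂ r : ℝ)) ≤
          8 * Real.exp (-((m / 2) * Real.log ((d : ℝ) - 1)))) ∧
    -- (c)
    (∀ d : ℕ, 3 ≤ d → ∃ c₁ : ℝ, 0 < c₁ ∧ ∀ k : ℕ, 2 ≤ k →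
      ∀ (V : Type u) [Fintype V] (G : SimpleGraph V) (r : V), IsRegularTree G r d k →
        ∀ y₁ y₂ : V, 2 ≤ G.dist y₁ r → 2 ≤ G.dist y₂ r →
          c₁ * twinPeaksProb G (fun K₁ K₂ => K₁ = r ∧ K₂ = y₂) ≤
            twinPeaksProb G (fun K₁ K₂ => K₁ = r ∧ K₂ = y₁)) ∧
    -- (d)
    (∀ d : ℕ, 3 ≤ d → ∃ c c' : ℝ, 0 < c ∧ 0 < c' ∧ ∀ k : ℕ, 2 ≤ k →
      ∀ n : ℝ, 2 * √(8 * (k : ℝ)) ≤ n →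
        (∀ (V : Type u) [Fintype V] (G : SimpleGraph V) (r : V), IsRegularTree G r d k →
          twinPeaksProb G (fun K₁ K₂ => n ≤ |(G.dist K₁ K₂ : ℝ) - (k : ℝ)|) ≤
            8 * Real.exp (-((n / 4) * Real.log ((d : ℝ) - 1))) +
              c * Real.exp (-((n / 2) * Real.log (d : ℝ)))) ∧
        8 * Real.exp (-((n / 4) * Real.log ((d : ℝ) - 1))) +
            c * Real.exp (-((n / 2) * Real.log (d : ℝ))) ≤
          c' * Real.exp (-((√(k : ℝ) / 64) * Real.log (d : ℝ)))) := by
  have hsqrt : ∀ k : ℕ, 2 ≤ k → (4 : ℝ) ≤ √(8 * (k : ℝ)) := by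
    intro k hk
    refine Real.le_sqrt_of_sq_le ?_
    have : (2 : ℝ) ≤ k := by exact_mod_cast hk
    linarith
  refine ⟨?_, ?_, ?_, ?_⟩
  · intro d k hd hk V _ G r hT y₁ y₂ hmax
    obtain ⟨p, H⟩ := hT.isTree.exists_isParentMap r
    by_contra hne
    have hpos := H.twinCount_true_pos hT hk (by omega)
    obtain ⟨z, hz⟩ : ∃ z, 2 ≤ G.dist r z := by
      classical
      have h1 := H.pow_le_card_two_le_dist hT hk
      have hd0 : (0 : ℝ) < d := by exact_mod_cast (by omega : 0 < d)
      have h2 : (0 : ℝ) < (Finset.univ.filter (fun y => 2 ≤ G.dist r y)).card :=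
        lt_of_lt_of_le (by positivity) h1
      obtain ⟨z, hz⟩ := Finset.card_pos.1 (Nat.cast_pos.1 h2)
      exact ⟨z, (Finset.mem_filter.1 hz).2⟩
    have h1 := hmax r z
    rw [twinPeaksProb_eq_div, twinPeaksProb_eq_div, div_le_div_iff_of_pos_right hpos,
      twinCount_singleton, twinCount_singleton] at h1
    have h2 := H.card_twinLabelings_root_ge hT (by omega) hz
    have h3 := H.card_twinLabelings_lt hT (by omega) hd hne y₂
    linarith
  · intro d k hd hk m hm V _ G r hT
    obtain ⟨p, H⟩ := hT.isTree.exists_isParentMap r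
    simp only [le_min_iff, SimpleGraph.dist_comm (v := r)]
    exact H.twinPeaksProb_far_le hT hk hd ((hsqrt k hk).trans hm)
  · intro d hd
    have hD : (3 : ℝ) ≤ d := by exact_mod_cast hd
    -- The ratio of the lower bound `S / d` to the upper bound `2 * S * (1 + 1)`, with `S` the
    -- number of labelings decreasing away from the root.
    refine ⟨1 / (4 * d), by positivity, ?_⟩
    intro k hk V _ G r hT y₁ y₂ h₁ h₂
    obtain ⟨p, H⟩ := hT.isTree.exists_isParentMap r
    have hpos := H.twinCount_true_pos hT hk hd
    rw [SimpleGraph.dist_comm] at h₁ h₂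
    rw [twinPeaksProb_eq_div, twinPeaksProb_eq_div, ← mul_div_assoc,
      div_le_div_iff_of_pos_right hpos, twinCount_singleton, twinCount_singleton]
    refine le_trans ?_ (H.card_twinLabelings_root_ge hT hd h₁)
    have h3 := H.card_twinLabelings_le hT (by omega) hd r y₂
    have h4 := movingCost_le_one hd (G.dist r r)
    have h5 := movingCost_le_one hd (G.dist r y₂)
    have hS : (0 : ℝ) ≤ (rootedLabelings p r).card := Nat.cast_nonneg _
    have h6 : ((twinLabelings G r y₂).card : ℝ) ≤ 4 * (rootedLabelings p r).card := by nlinarith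
    refine (mul_le_mul_of_nonneg_left h6 (by positivity)).trans (le_of_eq ?_)
    have : (d : ℝ) ≠ 0 := by linarith
    field_simp
  · intro d hd
    have hD : (3 : ℝ) ≤ d := by exact_mod_cast hd
    refine ⟨20 * ((d : ℝ) + 2) * d, 8 + 20 * ((d : ℝ) + 2) * d, by positivity, by positivity, ?_⟩
    intro k hk n hn
    have hk4 := hsqrt k hk
    refine ⟨?_, ?_⟩
    · intro V _ G r hT
      obtain ⟨p, H⟩ := hT.isTree.exists_isParentMap r
      have hfar := H.twinPeaksProb_far_le hT hk hd (m := n / 2) (by linarith)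
      have hnear := H.twinPeaksProb_near_le hT hk hd n
      rw [show n / 2 / 2 = n / 4 by ring] at hfar
      refine le_trans ?_ (add_le_add hfar hnear)
      have hpos := H.twinCount_true_pos hT hk hd
      rw [twinPeaksProb_eq_div, twinPeaksProb_eq_div, twinPeaksProb_eq_div, ← add_div,
        div_le_div_iff_of_pos_right hpos]
      refine twinCount_le_of_imp G fun x y hxy => ?_
      have t1 : (G.dist x y : ℝ) ≤ G.dist r x + G.dist r y := by
        have := hT.isTree.connected.dist_triangle (u := x) (v := r) (w := y)
        rw [SimpleGraph.dist_comm (u := x) (v := r)] at this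
        exact_mod_cast this
      have t2 : (G.dist r y : ℝ) ≤ G.dist r x + G.dist x y := by
        exact_mod_cast hT.isTree.connected.dist_triangle (u := r) (v := x) (w := y)
      have t3 : (G.dist r x : ℝ) ≤ G.dist r y + G.dist x y := by
        have := hT.isTree.connected.dist_triangle (u := r) (v := y) (w := x)
        rw [SimpleGraph.dist_comm (u := y) (v := x)] at this
        exact_mod_cast this
      have t4 : (G.dist r x : ℝ) ≤ k := by exact_mod_cast hT.depth_le x
      have t5 : (G.dist r y : ℝ) ≤ k := by exact_mod_cast hT.depth_le y
      have t6 : (0 : ℝ) ≤ G.dist x y := Nat.cast_nonneg _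
      -- If one peak is within `n/2` of the root, the triangle inequality excludes a distance of at
      -- least `k + n`. With distance at most `k - n`, the other peak has depth at most `k - n/2`,
      -- and `n ≤ k` gives the same bound for the first.
      by_cases h : n / 2 ≤ (G.dist r x : ℝ) ∧ n / 2 ≤ (G.dist r y : ℝ)
      · exact Or.inl h
      · right
        have h' : (G.dist r x : ℝ) < n / 2 ∨ (G.dist r y : ℝ) < n / 2 := by
          by_contra hcon
          push Not at hcon
          exact h hcon
        rcases le_abs.1 hxy with h1 | h1 <;> rcases h' with h2 | h2 <;>
          constructor <;> linarith
    · have hlog : 0 < Real.log (d : ℝ) := Real.log_pos (by linarith)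
      have hlog2 := two_mul_log_sub_one_ge hd
      have hk0 : 0 ≤ √(k : ℝ) := Real.sqrt_nonneg _
      have hk8 : √(k : ℝ) ≤ √(8 * (k : ℝ)) :=
        Real.sqrt_le_sqrt (by linarith [Nat.cast_nonneg (α := ℝ) k])
      -- Since `d ≤ (d-1)²`, replacing `log (d-1)` by `log d` costs a factor 2 in the exponent; the
      -- `64` leaves ample room.
      have e1 : Real.exp (-((n / 4) * Real.log ((d : ℝ) - 1))) ≤
          Real.exp (-((√(k : ℝ) / 64) * Real.log (d : ℝ))) := by
        refine Real.exp_le_exp.2 (neg_le_neg ?_)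
        have h1 : √(k : ℝ) / 64 * Real.log d ≤ n / 8 * Real.log d :=
          mul_le_mul_of_nonneg_right (by linarith) hlog.le
        have h2 : n / 8 * Real.log d ≤ n / 8 * (2 * Real.log ((d : ℝ) - 1)) :=
          mul_le_mul_of_nonneg_left hlog2 (by linarith)
        linarith
      have e2 : Real.exp (-((n / 2) * Real.log (d : ℝ))) ≤
          Real.exp (-((√(k : ℝ) / 64) * Real.log (d : ℝ))) := by
        refine Real.exp_le_exp.2 (neg_le_neg ?_)
        exact mul_le_mul_of_nonneg_right (by linarith) hlog.le
      rw [add_mul]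
      exact add_le_add (mul_le_mul_of_nonneg_left e1 (by norm_num))
        (mul_le_mul_of_nonneg_left e2 (by positivity))
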